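/- Consider an asynchronous message-passing system that consists of $S$ servers, $W$ writers and $R$ readers; writers and readers are called clients. An implementation assigns a (deterministic) automaton to each server and each client. Clients communicate only with servers, over reliable bidirectional channels with unbounded delays; a server that receives a message from a client updates its state and replies to that client, and servers do not communicate with each other. Any number of clients and up to $t$ servers may crash. A writer may invoke $\mathit{write}(v)$ for a value $v$ of a set $V$ with at least two elements; a reader may invoke $\mathit{read}()$, which returns a value; a client has at most one pending operation. In one round-trip of an operation, the client sends a message to every server and collects replies; from the replies received the client decides to wait for further ones, to start another round-trip, or to return. An implementation is wait-free if every operation invoked by a client that does not crash eventually returns, in every run in which at most $t$ servers crash and every message between a client and a server that do not crash is eventually delivered. It is atomic if, for each finite execution in which every invoked operation has returned, there is a permutation $\pi$ of all its operations such that an operation that returns before another one is invoked appears earlier in $\pi$, and each read returns the value written by the latest preceding write in $\pi$ (or the fixed initial content of the register if there is none). **Theorem (W1R$k$ impossibility).** Let $t \ge 1$, $W \ge 2$ and $R \ge 2$, and let $S$ be arbitrary. There is no wait-free atomic register implementation in which every write finishes in one round-trip and every read finishes in two round-trips. More generally, for every $k \ge 2$ there is no wait-free atomic register implementation in which every write finishes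 in one round-trip and every read finishes in at most $k$ round-trips. -/

import Mathlib

/-!
Emulation of a multi-writer multi-reader register in an asynchronous client-server
message-passing system with crash failures.
-/

universe u v

namespace Register

/-- Clients: `W` writers and `R` readers. -/
abbrev Client (W R : ℕ) : Type := Fin W ⊕ Fin R

/-- Argument of an operation: a writer invokes `write(v)`, a reader invokes `read()`. -/
abbrev Arg {W R : ℕ} (V : Type v) : Client W R → Type v
  | .inl _ => V
  | .inr _ => PUnit

/-- Response of an operation: a write returns an acknowledgement, a read returns the content of
the register, where `none` stands for "no value" (a possible initial content). -/
abbrev Ret {W R : ℕ} (V : Type v) : Client W R → Type v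
  | .inl _ => PUnit
  | .inr _ => Option V

/-! ### Histories and atomicity -/

/-- Invocation and response events. -/
inductive Event (W R : ℕ) (V : Type v) : Type v
  | inv (c : Client W R) (a : Arg V c)
  | resp (c : Client W R) (r : Ret V c)

/-- The client at which an event takes place. -/
def Event.client {W R : ℕ} {V : Type v} : Event W R V → Client W R
  | .inv c _ => c
  | .resp c _ => c

/-- Each invocation is immediately followed by its matching response. -/
def Sequential {W R : ℕ} {V : Type v} : List (Event W R V) → Prop
  | [] => True
  | .inv c _ :: .resp c' _ :: l => c = c' ∧ Sequential l
  | _ => False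

/-- A sequence of events is well-formed if its restriction to each client is sequential.
In particular every operation in it is complete. -/
def WellFormed {W R : ℕ} {V : Type v} (σ : List (Event W R V)) : Prop :=
  ∀ c : Client W R, Sequential (σ.filter fun e => e.client = c)

/-- An operation of a sequence of events, with the times (positions) of its two events. -/
structure Operation (W R : ℕ) (V : Type v) : Type v where
  client : Client W R
  arg : Arg V client
  ret : Ret V client
  start : ℕ
  finish : ℕ

/-- `o` is an operation of `σ`: an invocation together with the next event of the same client,
which is the matching response. -/
def IsOperationOf {W R : ℕ} {V : Type v} (σ : List (Event W R V)) (o : Operation W R V) : Prop :=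
  o.start < o.finish ∧
  σ[o.start]? = some (.inv o.client o.arg) ∧
  σ[o.finish]? = some (.resp o.client o.ret) ∧
  ∀ m, o.start < m → m < o.finish → ∀ e, σ[m]? = some e → e.client ≠ o.client

/-- Real-time order: `o` returns before `o'` is invoked. -/
def Operation.Precedes {W R : ℕ} {V : Type v} (o o' : Operation W R V) : Prop :=
  o.finish < o'.start

/-- The value written by an operation, if it is a write. -/
def Operation.written {W R : ℕ} {V : Type v} : Operation W R V → Option V
  | ⟨.inl _, v, _, _, _⟩ => some v
  | ⟨.inr _, _, _, _, _⟩ => none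

/-- The content returned by an operation, if it is a read. -/
def Operation.readResult {W R : ℕ} {V : Type v} : Operation W R V → Option (Option V)
  | ⟨.inl _, _, _, _, _⟩ => none
  | ⟨.inr _, _, x, _, _⟩ => some x

/-- Content of a register with initial content `init` after a sequence of operations: the value of
the latest write, or `init` if there is no write. -/
def content {W R : ℕ} {V : Type v} (init : Option V) (l : List (Operation W R V)) : Option V :=
  match (l.filterMap Operation.written).getLast? with
  | some v => some v
  | none => init

/-- There is a permutation `π` of all operations of `σ` that respects the real-time order and in
which each read returns the value written by the latest preceding write. -/
def Atomic {W R : ℕ} {V : Type v} (init : Option V) (σ : List (Event W R V)) : Prop :=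
  ∃ π : List (Operation W R V), π.Nodup ∧ (∀ o, o ∈ π ↔ IsOperationOf σ o) ∧
    (∀ (i j : ℕ) (o o' : Operation W R V), π[i]? = some o → π[j]? = some o' →
      o.Precedes o' → i < j) ∧
    (∀ (i : ℕ) (o : Operation W R V) (x : Option V), π[i]? = some o → o.readResult = some x →
      x = content init (π.take i))

/-! ### Implementations -/

/-- What a client does on receipt of a reply while it is executing an operation: wait for further
replies, start one more round-trip by sending a message to every server, or return. -/
inductive Outcome (S : ℕ) {W R : ℕ} (V : Type v) (M : Type u) (c : Client W R) : Type (max u v)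
  | wait
  | nextRound (msgs : Fin S → M)
  | return (r : Ret V c)

/-- An implementation: one automaton for each server and for each client.
A server that receives a message from a client updates its state and replies to that client.
An invocation starts the first round-trip of the operation, with a message to every server. -/
structure Implementation (S W R : ℕ) (V : Type v) : Type (max (u + 1) v) where
  Msg : Type u
  Reply : Type u
  ServerState : Type u
  ClientState : Type u
  serverInit : Fin S → ServerState
  serverStep : Fin S → ServerState → Client W R → Msg → ServerState × Reply
  clientInit : Client W R → ClientState
  clientInvoke : (c : Client W R) → ClientState → Arg V c → ClientState × (Fin S → Msg)
  clientReceive : (c : Client W R) → ClientState → Fin S → Reply →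
    ClientState × Outcome S V Msg c

namespace Implementation

variable {S W R : ℕ} {V : Type v}

/-- A global configuration, together with the record `hist` of the events so far.
`round c` is `none` if `c` has no pending operation, and `some j` if `c` has a pending operation
of which `j` round-trips have been started. The channels hold the messages in transit. -/
structure Config (A : Implementation.{u, v} S W R V) : Type (max u v) where
  server : Fin S → A.ServerState
  client : Client W R → A.ClientState
  round : Client W R → Option ℕ
  toServer : Multiset (Client W R × Fin S × A.Msg)
  toClient : Multiset (Fin S × Client W R × A.Reply)
  crashedServers : Finset (Fin S)
  crashedClients : Finset (Client W R)
  hist : List (Event W R V)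

/-- The initial configuration. -/
def initConfig (A : Implementation.{u, v} S W R V) : A.Config where
  server := A.serverInit
  client := A.clientInit
  round := fun _ => none
  toServer := 0
  toClient := 0
  crashedServers := ∅
  crashedClients := ∅
  hist := []

/-- The messages that `c` sends to all the servers in one round-trip. -/
def broadcast (A : Implementation.{u, v} S W R V) (c : Client W R) (msgs : Fin S → A.Msg) :
    Multiset (Client W R × Fin S × A.Msg) :=
  (Finset.univ : Finset (Fin S)).val.map fun s => (c, s, msgs s)

/-- Client `c` invokes an operation with argument `a`. -/
def Config.invoke {A : Implementation.{u, v} S W R V} (C : A.Config) (c : Client W R)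
    (a : Arg V c) : A.Config :=
  { C with
    client := Function.update C.client c (A.clientInvoke c (C.client c) a).1
    round := Function.update C.round c (some 1)
    toServer := C.toServer + A.broadcast c (A.clientInvoke c (C.client c) a).2
    hist := C.hist ++ [.inv c a] }

/-- Server `s` handles the message `m` from `c` and replies; `rest` is left in the channels. -/
def Config.serve {A : Implementation.{u, v} S W R V} (C : A.Config) (c : Client W R) (s : Fin S)
    (m : A.Msg) (rest : Multiset (Client W R × Fin S × A.Msg)) : A.Config :=
  { C with
    server := Function.update C.server s (A.serverStep s (C.server s) c m).1
    toServer := rest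
    toClient := (s, c, (A.serverStep s (C.server s) c m).2) ::ₘ C.toClient }

/-- Client `c` handles the reply `p` from `s`; `rest` is left in the channels. A client without a
pending operation only updates its state. -/
def Config.handle {A : Implementation.{u, v} S W R V} (C : A.Config) (s : Fin S) (c : Client W R)
    (p : A.Reply) (rest : Multiset (Fin S × Client W R × A.Reply)) : A.Config :=
  let D : A.Config :=
    { C with
      client := Function.update C.client c (A.clientReceive c (C.client c) s p).1
      toClient := rest }
  match C.round c with
  | none => D
  | some j =>
    match (A.clientReceive c (C.client c) s p).2 with
    | .wait => D
    | .nextRound msgs =>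
      { D with
        round := Function.update C.round c (some (j + 1))
        toServer := C.toServer + A.broadcast c msgs }
    | .return r =>
      { D with
        round := Function.update C.round c none
        hist := C.hist ++ [.resp c r] }

/-- The atomic actions. -/
inductive Action (A : Implementation.{u, v} S W R V) : Type (max u v)
  | invoke (c : Client W R) (a : Arg V c)
  | serve (c : Client W R) (s : Fin S) (m : A.Msg)
  | handle (s : Fin S) (c : Client W R) (p : A.Reply)
  | crashServer (s : Fin S)
  | crashClient (c : Client W R)

/-- The steps of the system: crashed processes take no further steps, at most `t` servers crash,
and a client invokes an operation only if it has none pending. Messages are delivered in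
any order. -/
inductive Step (A : Implementation.{u, v} S W R V) (t : ℕ) :
    A.Config → A.Action → A.Config → Prop
  | invoke (C : A.Config) (c : Client W R) (a : Arg V c) :
      c ∉ C.crashedClients → C.round c = none → Step A t C (.invoke c a) (C.invoke c a)
  | serve (C : A.Config) (c : Client W R) (s : Fin S) (m : A.Msg)
      (rest : Multiset (Client W R × Fin S × A.Msg)) :
      s ∉ C.crashedServers → C.toServer = (c, s, m) ::ₘ rest →
      Step A t C (.serve c s m) (C.serve c s m rest)
  | handle (C : A.Config) (s : Fin S) (c : Client W R) (p : A.Reply)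
      (rest : Multiset (Fin S × Client W R × A.Reply)) :
      c ∉ C.crashedClients → C.toClient = (s, c, p) ::ₘ rest →
      Step A t C (.handle s c p) (C.handle s c p rest)
  | crashServer (C : A.Config) (s : Fin S) :
      (insert s C.crashedServers).card ≤ t →
      Step A t C (.crashServer s) { C with crashedServers := insert s C.crashedServers }
  | crashClient (C : A.Config) (c : Client W R) :
      Step A t C (.crashClient c) { C with crashedClients := insert c C.crashedClients }

/-- The configurations reached by finite executions. -/
inductive Reachable (A : Implementation.{u, v} S W R V) (t : ℕ) : A.Config → Prop
  | init : Reachable A t A.initConfig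
  | step {C : A.Config} {α : A.Action} {D : A.Config} :
      Reachable A t C → Step A t C α D → Reachable A t D

/-- Every well-formed execution is atomic. -/
def IsAtomic (A : Implementation.{u, v} S W R V) (t : ℕ) (init : Option V) : Prop :=
  ∀ C : A.Config, A.Reachable t C → WellFormed C.hist → Atomic init C.hist

/-- A run, described by its successive configurations and actions. The action `none` means that
nothing happens, so that finite runs are included. -/
structure IsRun (A : Implementation.{u, v} S W R V) (t : ℕ) (C : ℕ → A.Config)
    (act : ℕ → Option A.Action) : Prop where
  zero : C 0 = A.initConfig
  step : ∀ n α, act n = some α → A.Step t (C n) α (C (n + 1))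
  idle : ∀ n, act n = none → C (n + 1) = C n

/-- Client `c` never crashes, and server `s` never crashes. -/
def Correct {A : Implementation.{u, v} S W R V} (C : ℕ → A.Config) (c : Client W R)
    (s : Fin S) : Prop :=
  ∀ n, c ∉ (C n).crashedClients ∧ s ∉ (C n).crashedServers

/-- The channels are reliable: every message between a client and a server that never crash is
eventually delivered. -/
structure IsFair {A : Implementation.{u, v} S W R V} (C : ℕ → A.Config)
    (act : ℕ → Option A.Action) : Prop where
  serve : ∀ n c s m, Correct C c s → (c, s, m) ∈ (C n).toServer →
    ∃ n' ≥ n, act n' = some (.serve c s m)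
  handle : ∀ n c s p, Correct C c s → (s, c, p) ∈ (C n).toClient →
    ∃ n' ≥ n, act n' = some (.handle s c p)

/-- In every fair run, in which any number of clients and at most `t` servers may crash, every
operation invoked by a client that does not crash eventually returns. -/
def IsWaitFree (A : Implementation.{u, v} S W R V) (t : ℕ) : Prop :=
  ∀ C act, A.IsRun t C act → IsFair C act →
    ∀ c, (∀ n, c ∉ (C n).crashedClients) →
      ∀ n, (C n).round c ≠ none → ∃ n' ≥ n, (C n').round c = none

/-- No write uses more than `kW` round-trips and no read uses more than `kR` round-trips. -/
def RoundTrips (A : Implementation.{u, v} S W R V) (t kW kR : ℕ) : Prop :=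
  ∀ C : A.Config, A.Reachable t C →
    (∀ (w : Fin W) (j : ℕ), C.round (.inl w) = some j → j ≤ kW) ∧
    (∀ (r : Fin R) (j : ℕ), C.round (.inr r) = some j → j ≤ kR)

/-- A wait-free atomic register implementation in which every write finishes in (at most) `kW`
and every read in (at most) `kR` round-trips, tolerating `t` server crashes. -/
structure IsAtomicRegister (A : Implementation.{u, v} S W R V) (t kW kR : ℕ)
    (init : Option V) : Prop where
  waitFree : A.IsWaitFree t
  atomic : A.IsAtomic t init
  roundTrips : A.RoundTrips t kW kR

end Implementation

end Register

/-! The proof combines a chain argument over the servers with a valency argument in the style of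
Fischer, Lynch and Paterson.

A write with a single round-trip fixes all its messages at its invocation. If two writers write `a`
and `b` concurrently, the adversary may therefore choose separately for every server which message
arrives first, and the resulting server state depends on that choice only. Once both writes have
returned, two readers start to read. By atomicity every read that is invoked after all the writes
returns the content left by the last write of the permutation, so all returned values are equal: the
servers and the two readers solve a consensus problem. They do so even if one server or one reader
crashes, by wait-freedom, and every execution is finite because the round-trips are bounded.

In such a system the decision is already determined by the initial configuration
(`AsyncSystem.univalent`). An inductive proof works because steps of different processes commute,
and because a deciding run without steps of `p` can be replayed after any step of `p`. Consequently
the state of a single server cannot influence the decision: that server might take no step until a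
read has returned (`AllReturn.congr_server`).

Now reverse the order of the two writes at one server after the other. The returned value stays the
same along the chain. At one end all servers are as after a complete write of `a` followed by one of
`b`, which forces the reads to return `b`; at the other end the roles are exchanged and the reads
return `a`. This is a contradiction. -/

/-! ### Asynchronous systems of message-driven processes -/

namespace AsyncSystem

open Relation

/-- Processes `P` with local states `St` that react to messages `M` addressed to them: a process
that receives a message updates its state and sends further messages. -/
structure System (P : Type*) (St : P → Type*) (M : P → Type*) where
  react : (p : P) → St p → M p → St p × Multiset (Σ p, M p)

/-- The local states together with the messages in transit. -/
@[ext] structure Conf {P : Type*} (St : P → Type*) (M : P → Type*) where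
  state : (p : P) → St p
  buffer : Multiset (Σ p, M p)

variable {P : Type*} [DecidableEq P] {St : P → Type*} {M : P → Type*} {X : Type*}

/-- Process `p` receives some message in transit. -/
def Step (Φ : System P St M) (p : P) (C D : Conf St M) : Prop :=
  ∃ m rest, C.buffer = ⟨p, m⟩ ::ₘ rest ∧
    D = ⟨Function.update C.state p (Φ.react p (C.state p) m).1,
      rest + (Φ.react p (C.state p) m).2⟩

/-- Reachability by steps of processes other than `p`. -/
def ReachAvoiding (Φ : System P St M) (p : P) : Conf St M → Conf St M → Prop :=
  ReflTransGen fun C D => ∃ q, q ≠ p ∧ Step Φ q C D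

/-- Reachability by arbitrary steps. -/
def Reach (Φ : System P St M) : Conf St M → Conf St M → Prop :=
  ReflTransGen fun C D => ∃ q, Step Φ q C D

variable {Φ : System P St M}

theorem ReachAvoiding.reach {p : P} {C D : Conf St M} (h : ReachAvoiding Φ p C D) :
    Reach Φ C D :=
  ReflTransGen.mono (fun _ _ h => h.imp fun _ hq => hq.2) _ _ h

theorem Step.reach {p : P} {C D : Conf St M} (h : Step Φ p C D) : Reach Φ C D :=
  ReflTransGen.single ⟨p, h⟩

/-- Steps of different processes commute. -/
theorem Step.diamond {p q : P} (hpq : p ≠ q) {C D E : Conf St M} (hD : Step Φ p C D)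
    (hE : Step Φ q C E) : ∃ F, Step Φ q D F ∧ Step Φ p E F := by
  obtain ⟨m, r, hr, rfl⟩ := hD
  obtain ⟨m', r', hr', rfl⟩ := hE
  rw [hr, Multiset.cons_eq_cons] at hr'
  -- The two messages have different addressees, so they are different entries of the buffer, and
  -- each is still in transit after the other has been received.
  rcases hr' with ⟨h, -⟩ | ⟨-, s, rfl, rfl⟩
  · exact absurd (congrArg Sigma.fst h) hpq
  refine ⟨⟨Function.update (Function.update C.state p (Φ.react p (C.state p) m).1) q
      (Φ.react q (C.state q) m').1,
      s + (Φ.react p (C.state p) m).2 + (Φ.react q (C.state q) m').2⟩,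
    ⟨m', s + (Φ.react p (C.state p) m).2, by simp, ?_⟩,
    ⟨m, s + (Φ.react q (C.state q) m').2, by simp, ?_⟩⟩
  · simp [Function.update_of_ne hpq.symm]
  · simp only [Function.update_of_ne hpq]
    rw [Function.update_comm hpq, add_right_comm]

/-- The step of `p` is moved past the run by one diamond for each step of the run. -/
theorem ReachAvoiding.commute {p : P} {C D E : Conf St M} (hD : ReachAvoiding Φ p C D)
    (hE : Step Φ p C E) : ∃ F, ReachAvoiding Φ p E F ∧ Step Φ p D F := by
  induction hD with
  | refl => exact ⟨E, .refl, hE⟩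
  | tail _ h ih =>
    obtain ⟨F, hF, hs⟩ := ih
    obtain ⟨q, hq, h⟩ := h
    obtain ⟨G, h1, h2⟩ := Step.diamond hq h hs
    exact ⟨G, hF.tail ⟨q, hq, h2⟩, h1⟩

/-- Steps of other processes do not depend on the state of `p`. -/
theorem ReachAvoiding.congr {p : P} {C D C' : Conf St M} (hD : ReachAvoiding Φ p C D)
    (hs : ∀ q, q ≠ p → C'.state q = C.state q) (hb : C'.buffer = C.buffer) :
    ∃ D', ReachAvoiding Φ p C' D' ∧ (∀ q, q ≠ p → D'.state q = D.state q) ∧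
      D'.buffer = D.buffer := by
  induction hD with
  | refl => exact ⟨C', .refl, hs, hb⟩
  | tail _ h ih =>
    obtain ⟨F, hF, hs, hb⟩ := ih
    obtain ⟨q, hq, m, r, hr, rfl⟩ := h
    refine ⟨_, hF.tail ⟨q, hq, m, r, hb.trans hr, rfl⟩, ?_, ?_⟩
    · intro q' hq'
      rw [hs q hq]
      by_cases h : q' = q
      · subst h; simp
      · simp [Function.update_of_ne h, hs q' hq']
    · simp [hs q hq]

/-- Some process has decided on `x`. -/
def Decided (dec : (p : P) → St p → X → Prop) (C : Conf St M) (x : X) : Prop :=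
  ∃ p, dec p (C.state p) x

variable {dec : (p : P) → St p → X → Prop}

theorem Decided.step (hdec : ∀ p s m x, dec p s x → dec p (Φ.react p s m).1 x)
    {C D : Conf St M} {p : P} {x : X} (hC : Decided dec C x) (h : Step Φ p C D) :
    Decided dec D x := by
  obtain ⟨q, hq⟩ := hC
  obtain ⟨m, r, -, rfl⟩ := h
  refine ⟨q, ?_⟩
  by_cases h : q = p
  · subst h; simpa using hdec _ _ _ _ hq
  · simpa [Function.update_of_ne h] using hq

theorem Decided.reach (hdec : ∀ p s m x, dec p s x → dec p (Φ.react p s m).1 x)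
    {C D : Conf St M} {x : X} (hC : Decided dec C x) (h : Reach Φ C D) : Decided dec D x := by
  induction h with
  | refl => exact hC
  | tail _ h ih => obtain ⟨q, h⟩ := h; exact ih.step hdec h

variable {G : Conf St M → ℕ → Prop}

theorem Reach.invariant (hstep : ∀ C n p D, G C n → Step Φ p C D → ∃ m < n, G D m)
    {C D : Conf St M} {n : ℕ} (hC : G C n) (h : Reach Φ C D) : ∃ m, G D m := by
  induction h with
  | refl => exact ⟨n, hC⟩
  | tail _ h ih =>
    obtain ⟨m, hm⟩ := ih
    obtain ⟨q, h⟩ := h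
    obtain ⟨m', -, h'⟩ := hstep _ _ _ _ hm h
    exact ⟨m', h'⟩

/-- In a terminating system that agrees on a decision even if an arbitrary process takes no
further steps, every configuration is univalent. -/
theorem univalent (hdec : ∀ p s m x, dec p s x → dec p (Φ.react p s m).1 x)
    (hstep : ∀ C n p D, G C n → Step Φ p C D → ∃ m < n, G D m)
    (hres : ∀ C n, G C n → ∀ p, ∃ D x, ReachAvoiding Φ p C D ∧ Decided dec D x)
    (hagree : ∀ C n, G C n → ∀ x y, Decided dec C x → Decided dec C y → x = y)
    {C : Conf St M} {n : ℕ} (hC : G C n) {D E : Conf St M} {x y : X} (hD : Reach Φ C D)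
    (hE : Reach Φ C E) (hx : Decided dec D x) (hy : Decided dec E y) : x = y := by
  induction n using Nat.strong_induction_on generalizing C D E x y with
  | _ n ih =>
  -- Decisions are permanent, so a decision already taken in `C` meets any later one in the same
  -- configuration, where agreement applies.
  have now {z w : X} {F : Conf St M} (hz : Decided dec C z) (hF : Reach Φ C F)
      (hw : Decided dec F w) : z = w := by
    obtain ⟨m, hm⟩ := Reach.invariant hstep hC hF
    exact hagree F m hm _ _ (hz.reach hdec hF) hw
  rcases ReflTransGen.cases_head hD with rfl | ⟨D₁, ⟨p, hp⟩, hD₁⟩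
  · exact now hx hE hy
  rcases ReflTransGen.cases_head hE with rfl | ⟨E₁, ⟨q, hq⟩, hE₁⟩
  · exact (now hy hD hx).symm
  obtain ⟨m, hm, hGm⟩ := hstep _ _ _ _ hC hp
  obtain ⟨m', hm', hGm'⟩ := hstep _ _ _ _ hC hq
  by_cases hpq : p = q
  · subst hpq
    -- The two steps deliver possibly different messages to the same process and need not commute. A
    -- deciding run that avoids `p` commutes with both, so `D₁` and `E₁` can both reach the decision
    -- `z`.
    obtain ⟨F, z, hF, hz⟩ := hres C n hC p
    obtain ⟨F₁, h₁, h₁'⟩ := hF.commute hp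
    obtain ⟨F₂, h₂, h₂'⟩ := hF.commute hq
    rw [ih m hm hGm hD₁ h₁.reach hx (hz.step hdec h₁'),
      ih m' hm' hGm' hE₁ h₂.reach hy (hz.step hdec h₂')]
  -- Here `D₁` and `E₁` have a common successor, and any decision reachable from it ties them
  -- together.
  · obtain ⟨F, h₁, h₂⟩ := hp.diamond hpq hq
    obtain ⟨k, -, hk⟩ := hstep _ _ _ _ hGm h₁
    obtain ⟨F', z, hF', hz⟩ := hres F k hk p
    rw [ih m hm hGm hD₁ (h₁.reach.trans hF'.reach) hx hz,
      ih m' hm' hGm' hE₁ (h₂.reach.trans hF'.reach) hy hz]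

end AsyncSystem

/-! ### Deliveries, termination and wait-freedom -/

namespace Register

namespace Implementation

open Relation

variable {S W R : ℕ} {V : Type v} {A : Implementation.{u, v} S W R V}

/-- The steps that deliver a message. -/
inductive Deliver (A : Implementation.{u, v} S W R V) : A.Config → A.Config → Prop
  | serve (C : A.Config) (c : Client W R) (s : Fin S) (m : A.Msg)
      (rest : Multiset (Client W R × Fin S × A.Msg)) :
      s ∉ C.crashedServers → C.toServer = (c, s, m) ::ₘ rest → Deliver A C (C.serve c s m rest)
  | handle (C : A.Config) (s : Fin S) (c : Client W R) (p : A.Reply)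
      (rest : Multiset (Fin S × Client W R × A.Reply)) :
      c ∉ C.crashedClients → C.toClient = (s, c, p) ::ₘ rest → Deliver A C (C.handle s c p rest)

theorem Deliver.step (t : ℕ) {C D : A.Config} (h : A.Deliver C D) : ∃ α, A.Step t C α D := by
  cases h with
  | serve c s m rest h₁ h₂ => exact ⟨_, .serve C c s m rest h₁ h₂⟩
  | handle s c p rest h₁ h₂ => exact ⟨_, .handle C s c p rest h₁ h₂⟩

theorem Reachable.deliver {t : ℕ} {C D : A.Config} (hC : A.Reachable t C)
    (h : ReflTransGen A.Deliver C D) : A.Reachable t D := by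
  induction h with
  | refl => exact hC
  | tail _ h ih => obtain ⟨α, h⟩ := h.step t; exact ih.step h

/-- The effect of handling a reply. -/
theorem Config.handle_cases (C : A.Config) (s : Fin S) (c : Client W R) (p : A.Reply)
    (rest : Multiset (Fin S × Client W R × A.Reply)) :
    let D : A.Config := { C with
      client := Function.update C.client c (A.clientReceive c (C.client c) s p).1
      toClient := rest }
    (C.handle s c p rest = D ∧ (C.round c = none ∨
      (A.clientReceive c (C.client c) s p).2 = .wait)) ∨
    (∃ j msgs, C.round c = some j ∧ (A.clientReceive c (C.client c) s p).2 = .nextRound msgs ∧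
      C.handle s c p rest = { D with
        round := Function.update C.round c (some (j + 1))
        toServer := C.toServer + A.broadcast c msgs }) ∨
    (∃ j r, C.round c = some j ∧ (A.clientReceive c (C.client c) s p).2 = .return r ∧
      C.handle s c p rest = { D with
        round := Function.update C.round c none
        hist := C.hist ++ [.resp c r] }) := by
  intro D
  cases hj : C.round c with
  | none => left; simp [Config.handle, hj, D]
  | some j =>
    rcases ho : (A.clientReceive c (C.client c) s p).2 with _ | msgs | r
    · left; simp [Config.handle, hj, ho, D]
    · right; left; exact ⟨j, msgs, rfl, rfl, by simp [Config.handle, hj, ho, D]⟩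
    · right; right; exact ⟨j, r, rfl, rfl, by simp [Config.handle, hj, ho, D]⟩

@[simp] theorem Config.handle_server (C : A.Config) (s : Fin S) (c : Client W R) (p : A.Reply)
    (rest : Multiset (Fin S × Client W R × A.Reply)) :
    (C.handle s c p rest).server = C.server := by
  rcases C.handle_cases s c p rest with ⟨h, -⟩ | ⟨_, _, _, _, h⟩ | ⟨_, _, _, _, h⟩ <;> rw [h]

@[simp] theorem Config.handle_toClient (C : A.Config) (s : Fin S) (c : Client W R) (p : A.Reply)
    (rest : Multiset (Fin S × Client W R × A.Reply)) :
    (C.handle s c p rest).toClient = rest := by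
  rcases C.handle_cases s c p rest with ⟨h, -⟩ | ⟨_, _, _, _, h⟩ | ⟨_, _, _, _, h⟩ <;> rw [h]

@[simp] theorem Config.handle_client (C : A.Config) (s : Fin S) (c : Client W R) (p : A.Reply)
    (rest : Multiset (Fin S × Client W R × A.Reply)) :
    (C.handle s c p rest).client =
      Function.update C.client c (A.clientReceive c (C.client c) s p).1 := by
  rcases C.handle_cases s c p rest with ⟨h, -⟩ | ⟨_, _, _, _, h⟩ | ⟨_, _, _, _, h⟩ <;> rw [h]

@[simp] theorem Config.handle_crashedServers (C : A.Config) (s : Fin S) (c : Client W R)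
    (p : A.Reply) (rest : Multiset (Fin S × Client W R × A.Reply)) :
    (C.handle s c p rest).crashedServers = C.crashedServers := by
  rcases C.handle_cases s c p rest with ⟨h, -⟩ | ⟨_, _, _, _, h⟩ | ⟨_, _, _, _, h⟩ <;> rw [h]

@[simp] theorem Config.handle_crashedClients (C : A.Config) (s : Fin S) (c : Client W R)
    (p : A.Reply) (rest : Multiset (Fin S × Client W R × A.Reply)) :
    (C.handle s c p rest).crashedClients = C.crashedClients := by
  rcases C.handle_cases s c p rest with ⟨h, -⟩ | ⟨_, _, _, _, h⟩ | ⟨_, _, _, _, h⟩ <;> rw [h]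

theorem Config.handle_toServer_le (C : A.Config) (s : Fin S) (c : Client W R)
    (p : A.Reply) (rest : Multiset (Fin S × Client W R × A.Reply)) :
    C.toServer ≤ (C.handle s c p rest).toServer := by
  rcases C.handle_cases s c p rest with ⟨h, -⟩ | ⟨_, _, _, _, h⟩ | ⟨_, _, _, _, h⟩ <;> rw [h]
  exact Multiset.le_add_right _ _

theorem Deliver.crashed {C D : A.Config} (h : ReflTransGen A.Deliver C D) :
    D.crashedServers = C.crashedServers ∧ D.crashedClients = C.crashedClients := by
  induction h with
  | refl => exact ⟨rfl, rfl⟩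
  | tail _ h ih =>
    rw [← ih.1, ← ih.2]
    cases h with
    | serve c s m rest _ _ => exact ⟨rfl, rfl⟩
    | handle s c p rest _ _ => simp

/-- A delivery extends the history by responses to pending operations only. -/
theorem Deliver.hist {C D : A.Config} (h : ReflTransGen A.Deliver C D) :
    (∃ L, D.hist = C.hist ++ L ∧
      ∀ e ∈ L, C.round e.client ≠ none ∧ ∃ c r, e = Event.resp c r) ∧
    ∀ c, C.round c = none → D.round c = none := by
  induction h with
  | refl => exact ⟨⟨[], by simp, by simp⟩, fun _ h => h⟩
  | @tail D E _ h ih =>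
    obtain ⟨⟨L, hL, hL'⟩, hr⟩ := ih
    cases h with
    | serve c s m rest _ _ => exact ⟨⟨L, hL, hL'⟩, hr⟩
    | handle s c p rest _ _ =>
      rcases D.handle_cases s c p rest with ⟨h, -⟩ | ⟨j, _, hj, _, h⟩ | ⟨j, r, hj, _, h⟩ <;> rw [h]
      · exact ⟨⟨L, hL, hL'⟩, hr⟩
      · refine ⟨⟨L, hL, hL'⟩, fun c' h' => ?_⟩
        have : c' ≠ c := by rintro rfl; simp [hr _ h'] at hj
        simpa [Function.update_of_ne this] using hr _ h'
      · refine ⟨⟨L ++ [.resp c r], by simp [hL], ?_⟩, fun c' h' => ?_⟩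
        · intro e he
          rcases List.mem_append.1 he with he | he
          · exact hL' e he
          · obtain rfl : e = .resp c r := by simpa using he
            refine ⟨fun h' => ?_, c, r, rfl⟩
            simp [hr c h'] at hj
        · by_cases hc : c' = c
          · subst hc; simp
          · simpa [Function.update_of_ne hc] using hr _ h'

/-- Contribution of a pending operation to the bound on the number of deliveries. -/
def roundWeight (S K : ℕ) : Option ℕ → ℕ
  | none => 0
  | some j => (K - j) * (2 * S)

/-- A bound on the number of deliveries that are still possible if no operation uses more than `K`
round-trips. -/
def potential (K : ℕ) (C : A.Config) : ℕ :=
  2 * C.toServer.card + C.toClient.card + ∑ c, roundWeight S K (C.round c)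

theorem sum_roundWeight_update (K : ℕ) (f : Client W R → Option ℕ) (c : Client W R)
    (x : Option ℕ) :
    ∑ c', roundWeight S K (Function.update f c x c') + roundWeight S K (f c) =
      ∑ c', roundWeight S K (f c') + roundWeight S K x := by
  classical
  rw [← Finset.add_sum_erase _ _ (Finset.mem_univ c),
    ← Finset.add_sum_erase Finset.univ (fun c' => roundWeight S K (f c')) (Finset.mem_univ c)]
  have : ∑ c' ∈ Finset.univ.erase c, roundWeight S K (Function.update f c x c') =
      ∑ c' ∈ Finset.univ.erase c, roundWeight S K (f c') :=
    Finset.sum_congr rfl fun c' h => by rw [Function.update_of_ne (Finset.ne_of_mem_erase h)]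
  simp only [Function.update_self, this]
  omega

/-- A request counts twice and a reply once, so serving a request loses one unit and so does
consuming a reply. A new round-trip adds `S` requests, whose weight `2 * S` is exactly what
`roundWeight` loses. -/
theorem Deliver.potential_lt {K : ℕ} {C D : A.Config} (h : A.Deliver C D)
    (hD : ∀ c j, D.round c = some j → j ≤ K) : potential K D < potential K C := by
  cases h with
  | serve c s m rest _ h => simp [potential, Config.serve, h]; omega
  | handle s c p rest _ hp =>
    rcases C.handle_cases s c p rest with ⟨h, -⟩ | ⟨j, _, hj, _, h⟩ | ⟨j, r, hj, _, h⟩ <;>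
      rw [h] at hD ⊢
    · simp [potential, hp]
    -- The bound on the new round keeps the truncated subtraction `K - j` honest.
    · have hjK : j + 1 ≤ K := hD c _ (by simp)
      have key := sum_roundWeight_update (S := S) K C.round c (some (j + 1))
      have h₁ : roundWeight S K (some (j + 1)) = (K - (j + 1)) * (2 * S) := rfl
      have h₂ : roundWeight S K (some j) = (K - j) * (2 * S) := rfl
      rw [hj, h₁, h₂] at key
      have : (K - j) * (2 * S) = (K - (j + 1)) * (2 * S) + 2 * S := by
        rw [← Nat.succ_mul]; congr 1; omega
      simp only [potential, hp, Multiset.card_add, Multiset.card_cons, broadcast,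
        Multiset.card_map, Finset.card_val, Finset.card_univ, Fintype.card_fin]
      omega
    · have key := sum_roundWeight_update (S := S) K C.round c none
      have h₁ : roundWeight S K none = 0 := rfl
      rw [h₁] at key
      simp only [potential, hp, Multiset.card_cons]
      omega

/-- No message can be delivered. -/
def Config.Quiescent (C : A.Config) : Prop :=
  (∀ c s m, s ∉ C.crashedServers → (c, s, m) ∉ C.toServer) ∧
  (∀ s c p, c ∉ C.crashedClients → (s, c, p) ∉ C.toClient)

theorem exists_deliver {C : A.Config} (h : ¬ C.Quiescent) : ∃ D, A.Deliver C D := by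
  simp only [Config.Quiescent, not_and_or, not_forall, not_not] at h
  rcases h with ⟨c, s, m, hs, h⟩ | ⟨s, c, p, hc, h⟩
  · obtain ⟨rest, h⟩ := Multiset.exists_cons_of_mem h
    exact ⟨_, .serve C c s m rest hs h⟩
  · obtain ⟨rest, h⟩ := Multiset.exists_cons_of_mem h
    exact ⟨_, .handle C s c p rest hc h⟩

theorem RoundTrips.le_max {t kW kR : ℕ} (h : A.RoundTrips t kW kR) {C : A.Config}
    (hC : A.Reachable t C) (c : Client W R) (j : ℕ) (hj : C.round c = some j) :
    j ≤ max kW kR := by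
  rcases c with w | r
  · exact ((h C hC).1 w j hj).trans (le_max_left _ _)
  · exact ((h C hC).2 r j hj).trans (le_max_right _ _)

/-- Bounded round-trips make every sequence of deliveries finite, so it suffices to deliver until
nothing is left. -/
theorem exists_quiescent {t kW kR : ℕ} (h : A.RoundTrips t kW kR) {C : A.Config}
    (hC : A.Reachable t C) : ∃ D, ReflTransGen A.Deliver C D ∧ D.Quiescent := by
  induction hn : potential (max kW kR) C using Nat.strong_induction_on generalizing C with
  | _ n ih =>
  by_cases hq : C.Quiescent
  · exact ⟨C, .refl, hq⟩
  obtain ⟨D, hD⟩ := exists_deliver hq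
  have hD' := hC.deliver (.single hD)
  obtain ⟨E, hE, hq⟩ := ih _ (hn ▸ hD.potential_lt (h.le_max hD')) hD' rfl
  exact ⟨E, hE.head hD, hq⟩

theorem Step.crashedClients_subset {t : ℕ} {C D : A.Config} {α : A.Action}
    (h : A.Step t C α D) : C.crashedClients ⊆ D.crashedClients := by
  cases h with
  | invoke c a _ _ => exact subset_rfl
  | serve c s m rest _ _ => exact subset_rfl
  | handle s c p rest _ _ => simp
  | crashServer s _ => exact subset_rfl
  | crashClient c => exact Finset.subset_insert _ _

theorem Step.toServer_mem {t : ℕ} {C D : A.Config} {α : A.Action} (h : A.Step t C α D)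
    {c : Client W R} {s : Fin S} {m : A.Msg} (hm : (c, s, m) ∈ C.toServer)
    (hα : α ≠ .serve c s m) : (c, s, m) ∈ D.toServer := by
  cases h with
  | invoke c a _ _ => exact Multiset.mem_add.2 (.inl hm)
  | serve c s m rest _ h =>
    rw [h, Multiset.mem_cons] at hm
    rcases hm with hm | hm
    · simp only [Prod.mk.injEq] at hm
      obtain ⟨rfl, rfl, rfl⟩ := hm
      exact absurd rfl hα
    · exact hm
  | handle s c p rest _ _ => exact Multiset.mem_of_le (C.handle_toServer_le s c p rest) hm
  | crashServer s _ => exact hm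
  | crashClient c => exact hm

theorem Step.toClient_mem {t : ℕ} {C D : A.Config} {α : A.Action} (h : A.Step t C α D)
    {s : Fin S} {c : Client W R} {p : A.Reply} (hm : (s, c, p) ∈ C.toClient)
    (hα : α ≠ .handle s c p) : (s, c, p) ∈ D.toClient := by
  cases h with
  | invoke c a _ _ => exact hm
  | serve c s m rest _ h => exact Multiset.mem_cons_of_mem hm
  | handle s c p rest _ h =>
    rw [h, Multiset.mem_cons] at hm
    rw [Config.handle_toClient]
    rcases hm with hm | hm
    · simp only [Prod.mk.injEq] at hm
      obtain ⟨rfl, rfl, rfl⟩ := hm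
      exact absurd rfl hα
    · exact hm
  | crashServer s _ => exact hm
  | crashClient c => exact hm

/-- A reachable configuration is the final one of a finite run. -/
theorem Reachable.exists_run {t : ℕ} {C : A.Config} (hC : A.Reachable t C) :
    ∃ (Cs : ℕ → A.Config) (act : ℕ → Option A.Action) (N : ℕ), A.IsRun t Cs act ∧
      (∀ n, N ≤ n → Cs n = C ∧ act n = none) ∧
      ∀ n, (Cs n).crashedClients ⊆ C.crashedClients := by
  induction hC with
  | init =>
    exact ⟨fun _ => A.initConfig, fun _ => none, 0,
      ⟨rfl, fun _ _ h => by simp at h, fun _ _ => rfl⟩, by simp, by simp⟩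
  | @step C α D _ h ih =>
    obtain ⟨Cs, act, N, hrun, hN, hsub⟩ := ih
    refine ⟨fun n => if n ≤ N then Cs n else D,
      fun n => if n < N then act n else if n = N then some α else none, N + 1,
      ⟨by simpa using hrun.zero, ?_, ?_⟩, ?_, ?_⟩
    · intro n β hβ
      rcases lt_trichotomy n N with hn | rfl | hn
      · simp only [hn, if_true] at hβ
        simpa [hn.le, Nat.succ_le_of_lt hn] using hrun.step n β hβ
      · obtain rfl : α = β := by simpa using hβ
        simpa [(hN n le_rfl).1] using h
      · simp [hn.not_gt, hn.ne'] at hβ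
    · intro n hn'
      rcases lt_trichotomy n N with hn | rfl | hn
      · simp only [hn, if_true] at hn'
        simpa [hn.le, Nat.succ_le_of_lt hn] using hrun.idle n hn'
      · simp at hn'
      · simp [hn.not_ge, (Nat.lt_succ_of_lt hn).not_ge]
    · intro n hn
      have : N < n := hn
      simp [this.not_ge, this.not_gt, this.ne']
    · intro n
      by_cases hn : n ≤ N
      · simpa [hn] using (hsub n).trans h.crashedClients_subset
      · simp [hn]

/-- In a quiescent configuration only crashed clients have a pending operation. -/
theorem IsWaitFree.round_eq_none {t : ℕ} (hA : A.IsWaitFree t) {C : A.Config}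
    (hC : A.Reachable t C) (hq : C.Quiescent) {c : Client W R} (hc : c ∉ C.crashedClients) :
    C.round c = none := by
  obtain ⟨Cs, act, N, hrun, hN, hsub⟩ := hC.exists_run
  -- The run idles forever in `C`. A message that is never delivered stays in its channel and hence
  -- is still there in `C`, which quiescence forbids for correct processes.
  have hfair : IsFair Cs act := by
    constructor
    · intro n c s m hcor hm
      by_contra! hne
      have : ∀ k, (c, s, m) ∈ (Cs (n + k)).toServer := by
        intro k
        induction k with
        | zero => exact hm
        | succ k ih =>
          cases hact : act (n + k) with
          | none => rw [← add_assoc, hrun.idle _ hact]; exact ih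
          | some α =>
            refine (hrun.step _ α hact).toServer_mem ih fun h => ?_
            exact hne (n + k) (by omega) (h ▸ hact)
      have h1 := this N
      rw [(hN _ (Nat.le_add_left N n)).1] at h1
      refine hq.1 _ _ _ ?_ h1
      rw [← (hN N le_rfl).1]
      exact (hcor N).2
    · intro n c s p hcor hm
      by_contra! hne
      have : ∀ k, (s, c, p) ∈ (Cs (n + k)).toClient := by
        intro k
        induction k with
        | zero => exact hm
        | succ k ih =>
          cases hact : act (n + k) with
          | none => rw [← add_assoc, hrun.idle _ hact]; exact ih
          | some α =>
            refine (hrun.step _ α hact).toClient_mem ih fun h => ?_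
            exact hne (n + k) (by omega) (h ▸ hact)
      have h1 := this N
      rw [(hN _ (Nat.le_add_left N n)).1] at h1
      refine hq.2 _ _ _ ?_ h1
      rw [← (hN N le_rfl).1]
      exact (hcor N).1
  by_contra hne
  obtain ⟨n, hn, h⟩ := hA Cs act hrun hfair c (fun n h => hc (hsub n h)) N
    (by rwa [(hN N le_rfl).1])
  rw [(hN n hn).1] at h
  exact hne h

/-- From every configuration, deliveries lead to a quiescent configuration in which only crashed
clients have a pending operation. -/
theorem IsAtomicRegister.exists_complete {t kW kR : ℕ} {init : Option V}
    (hA : A.IsAtomicRegister t kW kR init) {C : A.Config} (hC : A.Reachable t C) :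
    ∃ D, ReflTransGen A.Deliver C D ∧ D.Quiescent ∧
      ∀ c, c ∉ C.crashedClients → D.round c = none := by
  obtain ⟨D, hD, hq⟩ := exists_quiescent hA.roundTrips hC
  refine ⟨D, hD, hq, fun c hc => ?_⟩
  exact hA.waitFree.round_eq_none (hC.deliver hD) hq (by rwa [(Deliver.crashed hD).2])

end Implementation

end Register

/-! ### Histories of reachable configurations -/

namespace Register

variable {W R : ℕ} {V : Type v}

@[simp] theorem Event.client_inv (c : Client W R) (a : Arg V c) :
    (Event.inv c a).client = c := rfl

@[simp] theorem Event.client_resp (c : Client W R) (r : Ret V c) :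
    (Event.resp c r).client = c := rfl

theorem Sequential.append_pair {c : Client W R} (a : Arg V c) (r : Ret V c) :
    ∀ {l : List (Event W R V)}, Sequential l → Sequential (l ++ [.inv c a, .resp c r])
  | [], _ => ⟨rfl, trivial⟩
  | .inv _ _ :: .resp _ _ :: _, h => ⟨h.1, Sequential.append_pair a r h.2⟩
  | [.inv _ _], h => h.elim
  | .resp _ _ :: _, h => h.elim
  | .inv _ _ :: .inv _ _ :: _, h => h.elim

theorem getElem?_concat_eq_some {α : Type*} {l : List α} {e x : α} {n : ℕ}
    (h : (l ++ [e])[n]? = some x) : l[n]? = some x ∨ n = l.length ∧ e = x := by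
  rcases lt_or_ge n l.length with hn | hn
  · left; rwa [List.getElem?_append_left hn] at h
  · right
    rw [List.getElem?_append_right hn] at h
    obtain ⟨h₁, h₂⟩ := List.getElem?_eq_some_iff.1 h
    simp at h₁ h₂
    exact ⟨by omega, h₂⟩

theorem getElem?_append_of_eq_some {α : Type*} {l : List α} (l' : List α) {x : α} {n : ℕ}
    (h : l[n]? = some x) : (l ++ l')[n]? = some x := by
  rwa [List.getElem?_append_left (List.getElem?_eq_some_iff.1 h).1]

theorem IsOperationOf.append {σ : List (Event W R V)} {o : Operation W R V}
    (h : IsOperationOf σ o) (τ : List (Event W R V)) : IsOperationOf (σ ++ τ) o := by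
  obtain ⟨h₁, h₂, h₃, h₄⟩ := h
  refine ⟨h₁, getElem?_append_of_eq_some τ h₂, getElem?_append_of_eq_some τ h₃, ?_⟩
  intro m hm hm' e he
  have := (List.getElem?_eq_some_iff.1 h₃).1
  rw [List.getElem?_append_left (hm'.trans this)] at he
  exact h₄ m hm hm' e he

/-- No event of `c` in `σ` is later than position `m`. -/
def LastEvent (σ : List (Event W R V)) (c : Client W R) (m : ℕ) : Prop :=
  ∀ n, m < n → ∀ e, σ[n]? = some e → e.client ≠ c

theorem LastEvent.concat {σ : List (Event W R V)} {c : Client W R} {m : ℕ}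
    (h : LastEvent σ c m) {e : Event W R V} (he : e.client ≠ c) : LastEvent (σ ++ [e]) c m := by
  intro n hn x hx
  rcases getElem?_concat_eq_some hx with hx | ⟨rfl, rfl⟩
  · exact h n hn x hx
  · exact he

theorem isOperationOf_concat {σ : List (Event W R V)} {c : Client W R} {m : ℕ} {a : Arg V c}
    (hm : σ[m]? = some (.inv c a)) (h : LastEvent σ c m) (r : Ret V c) :
    IsOperationOf (σ ++ [.resp c r]) ⟨c, a, r, m, σ.length⟩ := by
  refine ⟨(List.getElem?_eq_some_iff.1 hm).1, getElem?_append_of_eq_some _ hm, by simp, ?_⟩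
  intro n hn hn' e he
  rw [List.getElem?_append_left hn'] at he
  exact h n hn e he

/-- The events of `σ` pair up to operations, up to one unanswered invocation by each client in
`pending`. -/
structure Paired (pending : Client W R → Prop) (σ : List (Event W R V)) : Prop where
  sequential : ∀ c, ¬ pending c → Sequential (σ.filter fun e => e.client = c)
  sequential_append : ∀ c, pending c → ∃ l a,
    σ.filter (fun e => e.client = c) = l ++ [.inv c a] ∧ Sequential l
  exists_inv : ∀ c, pending c → ∃ m a, σ[m]? = some (.inv c a) ∧ LastEvent σ c m
  of_resp : ∀ (n : ℕ) c r, σ[n]? = some (.resp c r) → ∃ a m, IsOperationOf σ ⟨c, a, r, m, n⟩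
  of_inv : ∀ (m : ℕ) c a, σ[m]? = some (.inv c a) →
    (∃ r n, IsOperationOf σ ⟨c, a, r, m, n⟩) ∨ pending c ∧ LastEvent σ c m

theorem Paired.nil : Paired (fun _ => False) ([] : List (Event W R V)) :=
  ⟨fun _ _ => trivial, fun _ h => h.elim, fun _ h => h.elim, fun _ _ _ h => by simp at h,
    fun _ _ _ h => by simp at h⟩

theorem Paired.invoke {pending : Client W R → Prop} {σ : List (Event W R V)}
    (h : Paired pending σ) {c : Client W R} (hc : ¬ pending c) (a : Arg V c) :
    Paired (fun c' => c' = c ∨ pending c') (σ ++ [.inv c a]) := by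
  constructor
  · intro c' hc'
    rw [not_or] at hc'
    have : ¬ c = c' := fun h => hc'.1 h.symm
    simpa [this] using h.sequential c' hc'.2
  · intro c' hc'
    by_cases hcc : c' = c
    · subst hcc
      exact ⟨_, a, by simp, h.sequential c' hc⟩
    · have : ¬ c = c' := fun h => hcc h.symm
      simpa [this] using h.sequential_append c' (hc'.resolve_left hcc)
  · intro c' hc'
    by_cases hcc : c' = c
    · subst hcc
      refine ⟨σ.length, a, by simp, fun n hn e he => ?_⟩
      have := (List.getElem?_eq_some_iff.1 he).1
      simp at this
      omega
    · obtain ⟨m, b, hm, hl⟩ := h.exists_inv c' (hc'.resolve_left hcc)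
      exact ⟨m, b, getElem?_append_of_eq_some _ hm, hl.concat fun h => hcc h.symm⟩
  · intro n c' r hn
    rcases getElem?_concat_eq_some hn with hn | ⟨-, hn⟩
    · obtain ⟨b, m, ho⟩ := h.of_resp n c' r hn
      exact ⟨b, m, ho.append _⟩
    · simp at hn
  · intro m c' b hm
    rcases getElem?_concat_eq_some hm with hm' | ⟨rfl, hm'⟩
    · rcases h.of_inv m c' b hm' with ⟨r, n, ho⟩ | ⟨hp, hl⟩
      · exact .inl ⟨r, n, ho.append _⟩
      · exact .inr ⟨.inr hp, hl.concat fun (h : c = c') => hc (h ▸ hp)⟩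
    · cases hm'
      refine .inr ⟨.inl rfl, fun n hn e he => ?_⟩
      have := (List.getElem?_eq_some_iff.1 he).1
      simp at this
      omega

theorem Paired.return {pending : Client W R → Prop} {σ : List (Event W R V)}
    (h : Paired pending σ) {c : Client W R} (hc : pending c) (r : Ret V c) :
    Paired (fun c' => c' ≠ c ∧ pending c') (σ ++ [.resp c r]) := by
  constructor
  · intro c' hc'
    by_cases hcc : c' = c
    · subst hcc
      obtain ⟨l, a, hl, hs⟩ := h.sequential_append c' hc
      simpa [hl] using hs.append_pair a r
    · have : ¬ c = c' := fun h => hcc h.symm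
      simpa [this] using h.sequential c' fun h => hc' ⟨hcc, h⟩
  · intro c' hc'
    have : ¬ c = c' := fun h => hc'.1 h.symm
    simpa [this] using h.sequential_append c' hc'.2
  · intro c' hc'
    obtain ⟨m, b, hm, hl⟩ := h.exists_inv c' hc'.2
    exact ⟨m, b, getElem?_append_of_eq_some _ hm, hl.concat fun h => hc'.1 h.symm⟩
  · intro n c' r' hn
    rcases getElem?_concat_eq_some hn with hn' | ⟨rfl, hn'⟩
    · obtain ⟨b, m, ho⟩ := h.of_resp n c' r' hn'
      exact ⟨b, m, ho.append _⟩
    · cases hn'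
      obtain ⟨m, a, hm, hl⟩ := h.exists_inv c hc
      exact ⟨a, m, isOperationOf_concat hm hl r⟩
  · intro m c' b hm
    rcases getElem?_concat_eq_some hm with hm' | ⟨-, hm'⟩
    · rcases h.of_inv m c' b hm' with ⟨r', n, ho⟩ | ⟨hp, hl⟩
      · exact .inl ⟨r', n, ho.append _⟩
      · by_cases hcc : c' = c
        · subst hcc
          exact .inl ⟨r, _, isOperationOf_concat hm' hl r⟩
        · exact .inr ⟨⟨hcc, hp⟩, hl.concat fun h => hcc h.symm⟩
    · simp at hm'

namespace Implementation

variable {S : ℕ} {A : Implementation.{u, v} S W R V}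

/-- The entry `round c` changes between `none` and `some _` exactly at the events of `c`. Once no
operation is pending, the history is thus well-formed and each of its events belongs to an
operation, so atomicity can be applied. -/
theorem Reachable.paired {t : ℕ} {C : A.Config} (hC : A.Reachable t C) :
    Paired (fun c => C.round c ≠ none) C.hist := by
  induction hC with
  | init => simpa [initConfig] using Paired.nil
  | @step C α D _ h ih =>
    cases h with
    | invoke c a _ hc =>
      have := ih.invoke (c := c) (by simpa using hc) a
      change Paired _ (C.hist ++ _)
      convert this using 2 with c'
      by_cases h : c' = c
      · subst h; simp [Config.invoke]
      · simp [Config.invoke, h]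
    | serve c s m rest _ _ => exact ih
    | handle s c p rest _ _ =>
      rcases C.handle_cases s c p rest with ⟨h, -⟩ | ⟨j, _, hj, _, h⟩ | ⟨j, r, hj, _, h⟩ <;> rw [h]
      · exact ih
      · convert ih using 2 with c'
        by_cases h : c' = c
        · subst h; simp [hj]
        · simp [h]
      · have := ih.return (c := c) (by simp [hj]) r
        convert this using 2 with c'
        by_cases h : c' = c
        · subst h; simp
        · simp [h]
    | crashServer s _ => exact ih
    | crashClient c => exact ih

theorem Reachable.wellFormed {t : ℕ} {C : A.Config} (hC : A.Reachable t C)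
    (h : ∀ c, C.round c = none) : WellFormed C.hist :=
  fun c => hC.paired.sequential c (by simpa using h c)

end Implementation

/-! ### Consequences of atomicity -/

/-- An operation of `σ` starts at an invocation that occurs in `σ`. -/
theorem IsOperationOf.inv_mem {σ : List (Event W R V)} {o : Operation W R V}
    (h : IsOperationOf σ o) : .inv o.client o.arg ∈ σ :=
  List.mem_of_getElem? h.2.1

/-- If all the events of `c` are in the left part and all those of `c'` are in the right part, then
the operations of `c` precede those of `c'`. -/
theorem precedes_of_append {σ τ : List (Event W R V)} {o o' : Operation W R V}
    (ho : IsOperationOf (σ ++ τ) o) (ho' : IsOperationOf (σ ++ τ) o')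
    (hσ : ∀ e ∈ σ, e.client ≠ o'.client) (hτ : ∀ e ∈ τ, e.client ≠ o.client) :
    o.Precedes o' := by
  have h₁ : o.finish < σ.length := by
    by_contra h
    have := ho.2.2.1
    rw [List.getElem?_append_right (not_lt.1 h)] at this
    exact hτ _ (List.mem_of_getElem? this) rfl
  have h₂ : σ.length ≤ o'.start := by
    by_contra h
    have := ho'.2.1
    rw [List.getElem?_append_left (not_le.1 h)] at this
    exact hσ _ (List.mem_of_getElem? this) rfl
  exact h₁.trans_le h₂

theorem Operation.written_eq_none {o : Operation W R V} {r : Fin R} (h : o.client = .inr r) :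
    o.written = none := by
  obtain ⟨c, a, b, m, n⟩ := o
  simp only at h
  subst h
  rfl

/-- The permutation required by atomicity, where every read follows all the writes. -/
theorem Atomic.exists_content {init : Option V} {σ τ : List (Event W R V)}
    (h : Atomic init (σ ++ τ)) (hσ : ∀ e ∈ σ, ∃ w, e.client = .inl w)
    (hτ : ∀ e ∈ τ, ∃ r, e.client = .inr r) :
    ∃ π : List (Operation W R V), (∀ o, o ∈ π ↔ IsOperationOf (σ ++ τ) o) ∧
      (∀ (i j : ℕ) (o o' : Operation W R V), π[i]? = some o → π[j]? = some o' →
        o.Precedes o' → i < j) ∧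
      ∀ r a x m n, IsOperationOf (σ ++ τ) ⟨.inr r, a, x, m, n⟩ → x = content init π := by
  obtain ⟨π, -, hπ, hord, hread⟩ := h
  refine ⟨π, hπ, hord, fun r a x m n ho => ?_⟩
  obtain ⟨i, hi⟩ := List.mem_iff_getElem?.1 ((hπ _).2 ho)
  rw [hread i _ x hi rfl]
  -- Every write precedes the read in real time, so no write stands behind the read in `π`; the
  -- content at the read is the final one.
  have hdrop : (π.drop i).filterMap Operation.written = [] := by
    rw [List.filterMap_eq_nil_iff]
    intro o' ho'
    rcases hc : o'.client with w | r'
    · obtain ⟨j, hj⟩ := List.mem_iff_getElem?.1 ho'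
      rw [List.getElem?_drop] at hj
      have hop := (hπ o').1 (List.mem_of_getElem? hj)
      have := hord _ _ _ _ hj hi (precedes_of_append hop ho
        (fun e he => by obtain ⟨w, hw⟩ := hσ e he; simp [hw])
        (fun e he => by obtain ⟨w, hw⟩ := hτ e he; simp [hw, hc]))
      omega
    · exact Operation.written_eq_none hc
  unfold content
  conv_rhs => rw [← List.take_append_drop i π, List.filterMap_append, hdrop, List.append_nil]

/-- If the last write is known, then so is the content of the register. -/
theorem content_eq_of_last {init : Option V} {π : List (Operation W R V)} {i : ℕ}
    {o : Operation W R V} {b : V} (hi : π[i]? = some o) (ho : o.written = some b)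
    (hlast : ∀ (j : ℕ) (o' : Operation W R V) (x : V), π[j]? = some o' → o'.written = some x →
      i < j → x = b) : content init π = some b := by
  obtain ⟨hlt, rfl⟩ := List.getElem?_eq_some_iff.1 hi
  have h₁ : π.filterMap Operation.written = (π.take i).filterMap Operation.written ++
      b :: (π.drop (i + 1)).filterMap Operation.written := by
    conv_lhs => rw [← List.take_append_drop i π, List.drop_eq_getElem_cons hlt]
    rw [List.filterMap_append, List.filterMap_cons_some ho]
  -- Later writes are allowed if they also write `b`; this avoids having to show that the write of
  -- `b` is a unique operation.
  have h₂ : (π.drop (i + 1)).filterMap Operation.written =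
      List.replicate ((π.drop (i + 1)).filterMap Operation.written).length b := by
    rw [List.eq_replicate_iff]
    refine ⟨rfl, fun x hx => ?_⟩
    obtain ⟨o', ho', hx⟩ := List.mem_filterMap.1 hx
    obtain ⟨j, hj⟩ := List.mem_iff_getElem?.1 ho'
    rw [List.getElem?_drop] at hj
    exact hlast _ _ _ hj hx (by omega)
  have h₃ : (π.filterMap Operation.written).getLast? = some b := by
    rw [h₁, h₂, ← List.replicate_succ, List.getLast?_append]
    simp [List.getLast?_replicate]
  simp [content, h₃]

/-- Reads that follow a write of `b`, which follows all other writes, return `b`. -/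
theorem Atomic.read_eq {init : Option V} {σ₁ σ₂ τ : List (Event W R V)} {w₁ w₂ : Fin W} {b : V}
    (hw : w₁ ≠ w₂) (h : Atomic init ((σ₁ ++ σ₂) ++ τ)) (hσ₁ : ∀ e ∈ σ₁, e.client = .inl w₁)
    (hσ₂ : ∀ e ∈ σ₂, e.client = .inl w₂) (hτ : ∀ e ∈ τ, ∃ r, e.client = .inr r)
    (hb : ∀ x : V, .inv (.inl w₂) x ∈ σ₂ → x = b) {u : PUnit} {k l : ℕ}
    (hop : IsOperationOf ((σ₁ ++ σ₂) ++ τ) ⟨.inl w₂, b, u, k, l⟩)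
    {r : Fin R} {a : PUnit} {x : Option V} {m n : ℕ}
    (hr : IsOperationOf ((σ₁ ++ σ₂) ++ τ) ⟨.inr r, a, x, m, n⟩) : x = some b := by
  have hσ : ∀ e ∈ σ₁ ++ σ₂, ∃ w, e.client = .inl w := by
    intro e he
    rcases List.mem_append.1 he with he | he
    · exact ⟨_, hσ₁ e he⟩
    · exact ⟨_, hσ₂ e he⟩
  obtain ⟨π, hπ, hord, hread⟩ := h.exists_content hσ hτ
  rw [hread r a x m n hr]
  obtain ⟨i, hi⟩ := List.mem_iff_getElem?.1 ((hπ _).2 hop)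
  refine content_eq_of_last hi rfl fun j o' y hj hy hij => ?_
  have ho' := (hπ o').1 (List.mem_of_getElem? hj)
  obtain ⟨c, a', r', m', n'⟩ := o'
  rcases c with w | r
  · obtain rfl : a' = y := by simpa [Operation.written] using hy
    have hmem := ho'.inv_mem
    simp only [List.mem_append] at hmem
    rcases hmem with (hmem | hmem) | hmem
    · obtain rfl : w = w₁ := by simpa using hσ₁ _ hmem
      rw [List.append_assoc] at ho' hop
      have := hord _ _ _ _ hj hi (precedes_of_append ho' hop
        (fun e he => by simp [hσ₁ e he, hw])
        (fun e he => by
          rcases List.mem_append.1 he with he | he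
          · simp [hσ₂ e he, hw.symm]
          · obtain ⟨r, hr⟩ := hτ e he; simp [hr]))
      omega
    · obtain rfl : w = w₂ := by simpa using hσ₂ _ hmem
      exact hb _ hmem
    · obtain ⟨r, hr⟩ := hτ _ hmem
      simp at hr
  · simp [Operation.written] at hy

end Register

/-! ### The system of servers and readers -/

namespace Register

namespace Implementation

open Relation AsyncSystem

variable {S W R : ℕ} {V : Type v}

/-- Local states of servers and readers; a reader also remembers its own events. -/
abbrev LocalState (A : Implementation.{u, v} S W R V) : Fin S ⊕ Fin R → Type (max u v)
  | .inl _ => ULift.{v} A.ServerState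
  | .inr _ => A.ClientState × Option ℕ × List (Event W R V)

/-- Messages to servers and readers. -/
abbrev Inbox (A : Implementation.{u, v} S W R V) : Fin S ⊕ Fin R → Type u
  | .inl _ => Client W R × A.Msg
  | .inr _ => Fin S × A.Reply

/-- A message in transit to a server. -/
def packRequest (A : Implementation.{u, v} S W R V) (x : Client W R × Fin S × A.Msg) :
    Σ p, A.Inbox p :=
  ⟨.inl x.2.1, (x.1, x.2.2)⟩

/-- A message in transit to a client, where those to writers are dropped. -/
def packReply (A : Implementation.{u, v} S W R V) :
    Fin S × Client W R × A.Reply → Multiset (Σ p, A.Inbox p)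
  | (_, .inl _, _) => 0
  | (s, .inr r, p) => {⟨.inr r, (s, p)⟩}

/-- The servers and the readers as a system of message-driven processes. -/
def system (A : Implementation.{u, v} S W R V) : System (Fin S ⊕ Fin R) A.LocalState A.Inbox where
  react
    | .inl s, q, m =>
      (⟨(A.serverStep s q.down m.1 m.2).1⟩,
        A.packReply (s, m.1, (A.serverStep s q.down m.1 m.2).2))
    | .inr r, q, m =>
      match q.2.1 with
      | none => (((A.clientReceive (.inr r) q.1 m.1 m.2).1, none, q.2.2), 0)
      | some j =>
        match (A.clientReceive (.inr r) q.1 m.1 m.2).2 with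
        | .wait => (((A.clientReceive (.inr r) q.1 m.1 m.2).1, some j, q.2.2), 0)
        | .nextRound msgs =>
          (((A.clientReceive (.inr r) q.1 m.1 m.2).1, some (j + 1), q.2.2),
            (A.broadcast (.inr r) msgs).map A.packRequest)
        | .return x =>
          (((A.clientReceive (.inr r) q.1 m.1 m.2).1, none, q.2.2 ++ [.resp (.inr r) x]), 0)

variable {A : Implementation.{u, v} S W R V}

/-- The part of a configuration that concerns servers and readers. -/
def Config.core (C : A.Config) : Conf A.LocalState A.Inbox where
  state
    | .inl s => ⟨C.server s⟩
    -- The global history would record the interleaving of the readers, and their steps would no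
    -- longer commute; each reader keeps only its own events.
    | .inr r => (C.client (.inr r), C.round (.inr r),
        C.hist.filter fun e => e.client = Sum.inr r)
  buffer := C.toServer.map A.packRequest + C.toClient.bind A.packReply

/-- A reader has decided on the value that it has returned. -/
def returned (A : Implementation.{u, v} S W R V) :
    (p : Fin S ⊕ Fin R) → A.LocalState p → Option V → Prop
  | .inl _, _, _ => False
  | .inr r, q, x => .resp (.inr r) x ∈ q.2.2

theorem returned_react (p : Fin S ⊕ Fin R) (q : A.LocalState p) (m : A.Inbox p) (x : Option V)
    (h : A.returned p q x) : A.returned p (A.system.react p q m).1 x := by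
  rcases p with s | r
  · exact h
  · obtain ⟨cs, rd, l⟩ := q
    have h : Event.resp (.inr r) x ∈ l := h
    rcases rd with _ | j
    · exact h
    · simp only [system]
      split
      · exact h
      · exact h
      · exact List.mem_append_left _ h

theorem decided_core {C : A.Config} {x : Option V} :
    Decided A.returned C.core x ↔ ∃ r, .resp (.inr r) x ∈ C.hist := by
  constructor
  · rintro ⟨s | r, h⟩
    · exact h.elim
    · exact ⟨r, List.mem_of_mem_filter h⟩
  · rintro ⟨r, h⟩
    exact ⟨.inr r, List.mem_filter.2 ⟨h, by simp⟩⟩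

theorem core_serve (C : A.Config) (c : Client W R) (s : Fin S) (m : A.Msg)
    (rest : Multiset (Client W R × Fin S × A.Msg)) :
    (C.serve c s m rest).core =
      ⟨Function.update C.core.state (.inl s)
          (A.system.react (.inl s) (C.core.state (.inl s)) (c, m)).1,
        rest.map A.packRequest + C.toClient.bind A.packReply +
          (A.system.react (.inl s) (C.core.state (.inl s)) (c, m)).2⟩ := by
  refine Conf.ext ?_ ?_
  · funext p
    dsimp only
    rcases p with s' | r
    · by_cases h : s' = s
      · subst h
        rw [Function.update_self]
        simp only [Config.core, Config.serve, system, Function.update_self]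
      · rw [Function.update_of_ne (by simpa using h)]
        simp only [Config.core, Config.serve, Function.update_of_ne h]
    · rw [Function.update_of_ne (by simp)]
      rfl
  · simp only [Config.core, Config.serve, system, Multiset.cons_bind]
    rw [add_assoc, add_comm (A.packReply _)]

theorem core_handle_inr (C : A.Config) (s : Fin S) (r : Fin R) (p : A.Reply)
    (rest : Multiset (Fin S × Client W R × A.Reply)) :
    (C.handle s (.inr r) p rest).core =
      ⟨Function.update C.core.state (.inr r)
          (A.system.react (.inr r) (C.core.state (.inr r)) (s, p)).1,
        C.toServer.map A.packRequest + rest.bind A.packReply +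
          (A.system.react (.inr r) (C.core.state (.inr r)) (s, p)).2⟩ := by
  have key : ∀ p', p' ≠ Sum.inr r → (C.handle s (.inr r) p rest).core.state p' =
      C.core.state p' := by
    intro p' hp'
    rcases p' with s' | r'
    · simp only [Config.core, Config.handle_server]
    · have hr : (Sum.inr r' : Client W R) ≠ .inr r := by simpa using hp'
      have hr' : ¬ r = r' := fun h => hr (by rw [h])
      rcases C.handle_cases s (.inr r) p rest with ⟨h, -⟩ | ⟨_, _, _, _, h⟩ | ⟨_, _, _, _, h⟩ <;>
        simp only [h, Config.core, Function.update_of_ne hr, List.filter_append]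
      simp [hr']
  refine Conf.ext ?_ ?_
  · funext p'
    dsimp only
    by_cases hp' : p' = Sum.inr r
    · subst hp'
      rw [Function.update_self]
      rcases C.handle_cases s (.inr r) p rest with ⟨h, h' | h'⟩ | ⟨_, _, h₁, h₂, h⟩ |
        ⟨_, _, h₁, h₂, h⟩
      · simp [h, Config.core, system, h']
      · rcases h₁ : C.round (.inr r) with _ | j <;> simp [h, Config.core, system, h', h₁]
      · simp [h, Config.core, system, h₁, h₂]
      · simp [h, Config.core, system, h₁, h₂]
    · rw [key p' hp']
      simp [hp']
  · rcases C.handle_cases s (.inr r) p rest with ⟨h, h' | h'⟩ | ⟨_, _, h₁, h₂, h⟩ |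
        ⟨_, _, h₁, h₂, h⟩
    · simp [h, Config.core, system, h']
    · rcases h₁ : C.round (.inr r) with _ | j <;> simp [h, Config.core, system, h', h₁]
    · simp [h, Config.core, system, h₁, h₂, add_right_comm]
    · simp [h, Config.core, system, h₁, h₂]

/-- A writer without a pending operation reacts to a late reply by a change of its own state only,
which the core does not record. -/
theorem core_handle_inl (C : A.Config) (s : Fin S) (w : Fin W) (p : A.Reply)
    (rest : Multiset (Fin S × Client W R × A.Reply)) (hw : C.round (.inl w) = none)
    (h : C.toClient = (s, .inl w, p) ::ₘ rest) :
    (C.handle s (.inl w) p rest).core = C.core := by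
  rcases C.handle_cases s (.inl w) p rest with ⟨h', -⟩ | ⟨_, _, h', _⟩ | ⟨_, _, h', _⟩
  · rw [h']
    refine Conf.ext ?_ ?_
    · funext p'
      rcases p' with s' | r' <;> simp [Config.core]
    · simp [Config.core, h, packReply]
  · simp [hw] at h'
  · simp [hw] at h'

theorem core_buffer_request {C : A.Config} {c : Client W R} {s : Fin S} {m : A.Msg}
    {rest : Multiset (Client W R × Fin S × A.Msg)} (h : C.toServer = (c, s, m) ::ₘ rest) :
    C.core.buffer = ⟨.inl s, (c, m)⟩ ::ₘ
      (rest.map A.packRequest + C.toClient.bind A.packReply) := by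
  simp [Config.core, h, packRequest]

theorem core_buffer_reply {C : A.Config} {s : Fin S} {r : Fin R} {p : A.Reply}
    {rest : Multiset (Fin S × Client W R × A.Reply)} (h : C.toClient = (s, .inr r, p) ::ₘ rest) :
    C.core.buffer = ⟨.inr r, (s, p)⟩ ::ₘ
      (C.toServer.map A.packRequest + rest.bind A.packReply) := by
  simp [Config.core, h, packReply]

/-- A process of the system of servers and readers has crashed. -/
def Config.Crashed (C : A.Config) : Fin S ⊕ Fin R → Prop
  | .inl s => s ∈ C.crashedServers
  | .inr r => .inr r ∈ C.crashedClients

/-- A delivery is a step of a process that has not crashed, or invisible. -/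
theorem Deliver.core_step {C D : A.Config} (h : A.Deliver C D)
    (hw : ∀ w, C.round (.inl w) = none) :
    D.core = C.core ∨ ∃ q, ¬ C.Crashed q ∧ AsyncSystem.Step A.system q C.core D.core := by
  cases h with
  | serve c s m rest hs h =>
    exact .inr ⟨.inl s, hs, _, _, core_buffer_request h, core_serve C c s m rest⟩
  | handle s c p rest hc h =>
    rcases c with w | r
    · exact .inl (core_handle_inl C s w p rest (hw w) h)
    · exact .inr ⟨.inr r, hc, _, _, core_buffer_reply h, core_handle_inr C s r p rest⟩

/-- Deliveries after a crash of `p` are steps of other processes. -/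
theorem Deliver.core_reachAvoiding {C D : A.Config} (h : ReflTransGen A.Deliver C D)
    (hw : ∀ w, C.round (.inl w) = none) {p : Fin S ⊕ Fin R} (hp : C.Crashed p) :
    ReachAvoiding A.system p C.core D.core := by
  induction h with
  | refl => exact .refl
  | @tail D E hD h ih =>
    rcases h.core_step (fun w => (Deliver.hist hD).2 _ (hw w)) with h | ⟨q, hq, h⟩
    · rwa [h]
    · refine ih.tail ⟨q, ?_, h⟩
      rintro rfl
      refine hq ?_
      have := Deliver.crashed hD
      rcases q with s | r
      · simpa [Config.Crashed, this.1] using hp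
      · simpa [Config.Crashed, this.2] using hp

/-- Steps of the system of servers and readers are deliveries. -/
theorem exists_deliver_of_core_step {C : A.Config} {p : Fin S ⊕ Fin R}
    {Y : Conf A.LocalState A.Inbox} (hp : ¬ C.Crashed p)
    (h : AsyncSystem.Step A.system p C.core Y) :
    ∃ D, A.Deliver C D ∧ D.core = Y := by
  obtain ⟨m, rest, hb, rfl⟩ := h
  have hm : ⟨p, m⟩ ∈ C.toServer.map A.packRequest + C.toClient.bind A.packReply := by
    change _ ∈ C.core.buffer
    simp [hb]
  rw [Multiset.mem_add, Multiset.mem_map, Multiset.mem_bind] at hm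
  rcases hm with ⟨⟨c, s, m'⟩, hm, he⟩ | ⟨⟨s, c, m'⟩, hm, he⟩
  · simp only [packRequest] at he
    cases he
    obtain ⟨rest', h⟩ := Multiset.exists_cons_of_mem hm
    refine ⟨_, .serve C c s m' rest' hp h, ?_⟩
    rw [core_buffer_request h, Multiset.cons_inj_right] at hb
    rw [core_serve, hb]
  · rcases c with w | r
    · simp [packReply] at he
    · simp only [packReply, Multiset.mem_singleton] at he
      cases he
      obtain ⟨rest', h⟩ := Multiset.exists_cons_of_mem hm
      refine ⟨_, .handle C s (.inr r) m' rest' hp h, ?_⟩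
      rw [core_buffer_reply h, Multiset.cons_inj_right] at hb
      rw [core_handle_inr, hb]

end Implementation

end Register

/-! ### Executions with two writes -/

namespace Register

namespace Implementation

open Relation AsyncSystem

variable {S W R : ℕ} {V : Type v} {A : Implementation.{u, v} S W R V}

/-- The servers in `U` handle the message that they have got from writer `w`. -/
theorem exists_serve (w : Fin W) (msgs : Fin S → A.Msg) (U : Finset (Fin S)) {C : A.Config}
    {rest : Multiset (Client W R × Fin S × A.Msg)} (hs : C.crashedServers = ∅)
    (h : C.toServer = U.val.map (fun s => (.inl w, s, msgs s)) + rest) :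
    ∃ D, ReflTransGen A.Deliver C D ∧ D.toServer = rest ∧ D.client = C.client ∧
      D.round = C.round ∧ D.hist = C.hist ∧
      (∀ s, D.server s = if s ∈ U then (A.serverStep s (C.server s) (.inl w) (msgs s)).1
        else C.server s) ∧
      ∀ x ∈ D.toClient, x ∈ C.toClient ∨ x.2.1 = .inl w := by
  induction U using Finset.induction_on generalizing C with
  | empty => exact ⟨C, .refl, by simpa using h, rfl, rfl, rfl, by simp, fun x hx => .inl hx⟩
  | @insert s U hsU ih =>
    rw [Finset.insert_val_of_notMem hsU, Multiset.map_cons, Multiset.cons_add] at h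
    have hd := Deliver.serve C (.inl w) s (msgs s) _ (by simp [hs]) h
    obtain ⟨D, hD, h₁, h₂, h₃, h₄, h₅, h₆⟩ :=
      ih (C := C.serve (.inl w) s (msgs s) _) hs rfl
    refine ⟨D, hD.head hd, h₁, h₂, h₃, h₄, fun s' => ?_, fun x hx => ?_⟩
    · rw [h₅ s']
      by_cases hss : s' = s
      · subst hss; simp [hsU, Config.serve]
      · simp [hss, Config.serve]
    · rcases h₆ x hx with h | h
      · rcases Multiset.mem_cons.1 h with rfl | h
        · exact .inr rfl
        · exact .inl h
      · exact .inr h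

/-- If all the messages of the writes have been served, then the writes can return. -/
theorem IsAtomicRegister.exists_finish {t k : ℕ} {init : Option V}
    (hA : A.IsAtomicRegister t 1 k init) (T : Set (Fin W)) {C : A.Config}
    (hC : A.Reachable t C) (hcc : C.crashedClients = ∅)
    (hts : C.toServer = 0) (htc : ∀ x ∈ C.toClient, ∃ w ∈ T, x.2.1 = .inl w)
    (hw : ∀ w j, C.round (.inl w) = some j → 1 ≤ j) :
    ∃ D, ReflTransGen A.Deliver C D ∧ D.toServer = 0 ∧ D.toClient = 0 ∧
      (∀ c, D.round c = none) ∧ D.server = C.server ∧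
      ∀ c, (∀ w ∈ T, c ≠ .inl w) → D.client c = C.client c := by
  obtain ⟨D, hD, hq, hround⟩ := hA.exists_complete hC
  have key : D.toServer = 0 ∧ (∀ x ∈ D.toClient, ∃ w ∈ T, x.2.1 = .inl w) ∧
      (∀ w j, D.round (.inl w) = some j → 1 ≤ j) ∧ D.server = C.server ∧
      ∀ c, (∀ w ∈ T, c ≠ .inl w) → D.client c = C.client c := by
    clear hq hround
    induction hD with
    | refl => exact ⟨hts, htc, hw, rfl, fun _ _ => rfl⟩
    | @tail D E hD h ih =>
      obtain ⟨h₁, h₂, h₃, h₄, h₅⟩ := ih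
      have hE : A.Reachable t E := hC.deliver (hD.tail h)
      cases h with
      | serve c s m rest _ h => simp [h₁] at h
      | handle s c p rest _ h =>
        obtain ⟨w, hw, rfl⟩ := h₂ (s, c, p) (by simp [h])
        refine ⟨?_, ?_, ?_, by simpa using h₄, ?_⟩
        · rcases D.handle_cases s (.inl w) p rest with ⟨h', -⟩ | ⟨j, _, hj, _, h'⟩ |
            ⟨j, r, hj, _, h'⟩
          · rw [h']; exact h₁
          -- One-round writes enter here: a pending write has already started its only round-trip,
          -- so it cannot send further messages that would change the servers.
          · have := (hA.roundTrips _ hE).1 w (j + 1) (by simp [h'])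
            have := h₃ w j hj
            omega
          · rw [h']; exact h₁
        · intro x hx
          rw [Config.handle_toClient] at hx
          exact h₂ x (by rw [h]; exact Multiset.mem_cons_of_mem hx)
        · intro w' j' hj'
          rcases D.handle_cases s (.inl w) p rest with ⟨h', -⟩ | ⟨j, _, hj, _, h'⟩ |
            ⟨j, r, hj, _, h'⟩
          · rw [h'] at hj'; exact h₃ w' j' hj'
          · by_cases hww : w' = w
            · subst hww
              simp [h'] at hj'
              omega
            · exact h₃ w' j' (by simpa [h', hww] using hj')
          · by_cases hww : w' = w
            · subst hww
              simp [h'] at hj'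
            · exact h₃ w' j' (by simpa [h', hww] using hj')
        · intro c hc
          rw [Config.handle_client, Function.update_of_ne (hc w hw)]
          exact h₅ c hc
  obtain ⟨h₁, -, -, h₄, h₅⟩ := key
  refine ⟨D, hD, h₁, ?_, fun c => hround c (by simp [hcc]), h₄, h₅⟩
  refine Multiset.eq_zero_of_forall_notMem fun ⟨s, c, p⟩ hx => hq.2 s c p ?_ hx
  simp [(Deliver.crashed hD).2, hcc]

/-- No process has crashed, no operation is pending, no message is in transit, no read has been
invoked, and the servers are in the states `q`. -/
structure Settled (A : Implementation.{u, v} S W R V) (t : ℕ) (q : Fin S → A.ServerState)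
    (C : A.Config) : Prop where
  reachable : A.Reachable t C
  crashedServers : C.crashedServers = ∅
  crashedClients : C.crashedClients = ∅
  toServer : C.toServer = 0
  toClient : C.toClient = 0
  round : ∀ c, C.round c = none
  server : ∀ s, C.server s = q s
  reader : ∀ r, C.client (.inr r) = A.clientInit (.inr r)
  hist : ∀ e ∈ C.hist, ∃ w, e.client = .inl w

theorem settled_initConfig (A : Implementation.{u, v} S W R V) (t : ℕ) :
    A.Settled t A.serverInit A.initConfig :=
  ⟨.init, rfl, rfl, rfl, rfl, fun _ => rfl, fun _ => rfl, fun _ => rfl, by simp [initConfig]⟩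

/-- One complete write. -/
theorem Settled.exists_write {t k : ℕ} {init : Option V} (hA : A.IsAtomicRegister t 1 k init)
    {q : Fin S → A.ServerState} {C : A.Config} (hC : A.Settled t q C) (w : Fin W) (b : V) :
    ∃ D, A.Settled t (fun s => (A.serverStep s (q s) (.inl w)
        ((A.clientInvoke (.inl w) (C.client (.inl w)) b).2 s)).1) D ∧
      (∀ w', w' ≠ w → D.client (.inl w') = C.client (.inl w')) ∧
      ∃ L, D.hist = C.hist ++ (.inv (.inl w) b :: L) ∧
        ∀ e ∈ L, e.client = .inl w ∧ ∃ c r, e = .resp c r := by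
  have hr₁ : A.Reachable t (C.invoke (.inl w) b) :=
    hC.reachable.step (.invoke C (.inl w) b (by simp [hC.crashedClients]) (hC.round _))
  obtain ⟨D, hD, h₁, h₂, h₃, h₄, h₅, h₆⟩ := exists_serve w
    (A.clientInvoke (.inl w) (C.client (.inl w)) b).2 Finset.univ (rest := 0)
    (C := C.invoke (.inl w) b) hC.crashedServers
    (by simp [Config.invoke, hC.toServer, broadcast])
  have hcr := Deliver.crashed hD
  have hDr := hr₁.deliver hD
  obtain ⟨E, hE, g₁, g₂, g₃, g₄, g₅⟩ := hA.exists_finish {w} hDr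
    (hcr.2.trans hC.crashedClients) h₁
    (fun x hx => by
      rcases h₆ x hx with h | h
      · simp [Config.invoke, hC.toClient] at h
      · exact ⟨w, rfl, h⟩)
    (fun w' j hj => by
      rw [h₃] at hj
      by_cases h : w' = w
      · subst h
        simp [Config.invoke] at hj
        omega
      · simp [Config.invoke, h, hC.round] at hj)
  have hcr' := Deliver.crashed hE
  obtain ⟨⟨L, hL, hL'⟩, -⟩ := Deliver.hist hE
  have hclient : ∀ c, c ≠ .inl w → E.client c = C.client c := by
    intro c hc
    rw [g₅ c (by simpa using hc), h₂]
    simp [Config.invoke, hc]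
  have hLw : ∀ e ∈ L, e.client = .inl w ∧ ∃ c r, e = .resp c r := by
    intro e he
    refine ⟨?_, (hL' e he).2⟩
    by_contra h
    refine (hL' e he).1 ?_
    rw [h₃]
    simp [Config.invoke, h, hC.round]
  have hhist : E.hist = C.hist ++ (.inv (.inl w) b :: L) := by
    rw [hL, h₄]
    simp [Config.invoke]
  refine ⟨E, ⟨hDr.deliver hE, ?_, ?_, g₁, g₂, g₃, ?_, ?_, ?_⟩, ?_, L, hhist, hLw⟩
  · exact hcr'.1.trans (hcr.1.trans hC.crashedServers)
  · exact hcr'.2.trans (hcr.2.trans hC.crashedClients)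
  · intro s
    rw [g₄, h₅ s]
    simp [Config.invoke, hC.server]
  · exact fun r => (hclient _ (by simp)).trans (hC.reader r)
  · intro e he
    rw [hhist, List.mem_append, List.mem_cons] at he
    rcases he with he | rfl | he
    · exact hC.hist e he
    · exact ⟨w, rfl⟩
    · exact ⟨w, (hLw e he).1⟩
  · exact fun w' hw' => hclient _ (by simpa using hw')

/-- The effect on the states of the servers of a first write of `b` by writer `w`. -/
def applyWrite (A : Implementation.{u, v} S W R V) (w : Fin W) (b : V)
    (q : Fin S → A.ServerState) (s : Fin S) : A.ServerState :=
  (A.serverStep s (q s) (.inl w) ((A.clientInvoke (.inl w) (A.clientInit (.inl w)) b).2 s)).1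

/-- Two consecutive writes. -/
theorem IsAtomicRegister.exists_write_write {t k : ℕ} {init : Option V}
    (hA : A.IsAtomicRegister t 1 k init) {w₁ w₂ : Fin W} (hw : w₁ ≠ w₂) (a b : V) :
    ∃ D σ₁ σ₂, A.Settled t (A.applyWrite w₂ b (A.applyWrite w₁ a A.serverInit)) D ∧
      D.hist = σ₁ ++ σ₂ ∧ (∀ e ∈ σ₁, e.client = .inl w₁) ∧ (∀ e ∈ σ₂, e.client = .inl w₂) ∧
      .inv (.inl w₂) b ∈ σ₂ ∧ ∀ x : V, .inv (.inl w₂) x ∈ σ₂ → x = b := by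
  obtain ⟨C, hC, hCc, L, hL, hL'⟩ := (A.settled_initConfig t).exists_write hA w₁ a
  obtain ⟨D, hD, -, M, hM, hM'⟩ := hC.exists_write hA w₂ b
  refine ⟨D, .inv (.inl w₁) a :: L, .inv (.inl w₂) b :: M, ?_, ?_, ?_, ?_, by simp, ?_⟩
  -- The first write leaves the second writer in its initial state, so its messages are those in
  -- `applyWrite`.
  · rw [hCc w₂ hw.symm] at hD
    exact hD
  · rw [hM, hL]
    simp [initConfig]
  · intro e he
    rcases List.mem_cons.1 he with rfl | he
    · rfl
    · exact (hL' e he).1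
  · intro e he
    rcases List.mem_cons.1 he with rfl | he
    · rfl
    · exact (hM' e he).1
  · intro x hx
    rcases List.mem_cons.1 hx with h | h
    · cases h; rfl
    · obtain ⟨-, c, r, h⟩ := hM' _ h
      simp at h

/-- The states of the servers if those in `T` get the message of the second writer first. -/
def mixedWrites (A : Implementation.{u, v} S W R V) (w₁ w₂ : Fin W) (a b : V)
    (T : Finset (Fin S)) (s : Fin S) : A.ServerState :=
  if s ∈ T then A.applyWrite w₁ a (A.applyWrite w₂ b A.serverInit) s
  else A.applyWrite w₂ b (A.applyWrite w₁ a A.serverInit) s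

/-- Two concurrent writes, whose messages reach each server in an arbitrary order. -/
theorem IsAtomicRegister.exists_mixedWrites {t k : ℕ} {init : Option V}
    (hA : A.IsAtomicRegister t 1 k init) {w₁ w₂ : Fin W} (hw : w₁ ≠ w₂) (a b : V)
    (T : Finset (Fin S)) : ∃ D, A.Settled t (A.mixedWrites w₁ w₂ a b T) D := by
  set m₁ := (A.clientInvoke (.inl w₁) (A.clientInit (.inl w₁)) a).2 with hm₁
  set m₂ := (A.clientInvoke (.inl w₂) (A.clientInit (.inl w₂)) b).2 with hm₂
  set C₁ := A.initConfig.invoke (.inl w₁) a with hC₁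
  set C₂ := C₁.invoke (.inl w₂) b with hC₂
  have hr₁ : A.Reachable t C₁ := Reachable.init.step (.invoke _ _ _ (by simp [initConfig]) rfl)
  have hr₂ : A.Reachable t C₂ := hr₁.step (.invoke _ _ _ (by simp [hC₁, Config.invoke, initConfig])
    (by simp [hC₁, Config.invoke, initConfig, hw.symm]))
  -- The messages are served in three batches: those of `w₁` to the servers outside `T`, all those
  -- of `w₂`, and the remaining ones of `w₁`.
  have hts : C₂.toServer = (Finset.univ.filter (· ∉ T)).val.map (fun s => (.inl w₁, s, m₁ s)) +
      (Finset.univ.val.map (fun s => (.inl w₂, s, m₂ s)) +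
        ((Finset.univ.filter (· ∈ T)).val.map (fun s => (.inl w₁, s, m₁ s)) + 0)) := by
    have : (Finset.univ : Finset (Fin S)).val =
        (Finset.univ.filter (· ∉ T)).val + (Finset.univ.filter (· ∈ T)).val := by
      rw [Finset.filter_val, Finset.filter_val, add_comm, Multiset.filter_add_not]
    have h : C₂.toServer = Finset.univ.val.map (fun s => (.inl w₁, s, m₁ s)) +
        Finset.univ.val.map (fun s => (.inl w₂, s, m₂ s)) := by
      simp [hC₂, hC₁, Config.invoke, initConfig, broadcast, hm₁, hm₂, hw.symm]
    rw [h]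
    conv_lhs => lhs; rw [this, Multiset.map_add]
    rw [add_zero, add_assoc, add_comm (Multiset.map _ (Finset.univ.filter (· ∈ T)).val)]
  obtain ⟨D₁, hD₁, e₁, e₂, e₃, e₄, e₅, e₆⟩ := exists_serve w₁ m₁ _ (C := C₂) rfl hts
  obtain ⟨D₂, hD₂, f₁, f₂, f₃, f₄, f₅, f₆⟩ := exists_serve w₂ m₂ _ (Deliver.crashed hD₁).1 e₁
  have hcr₂ := Deliver.crashed (hD₁.trans hD₂)
  obtain ⟨D₃, hD₃, g₁, g₂, g₃, g₄, g₅, g₆⟩ := exists_serve w₁ m₁ _ hcr₂.1 f₁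
  have hpath := (hD₁.trans hD₂).trans hD₃
  have hcr₃ := Deliver.crashed hpath
  have hround : D₃.round = C₂.round := g₃.trans (f₃.trans e₃)
  have hround' : ∀ c, (∀ w, c ≠ .inl w) → C₂.round c = none := by
    intro c hc
    simp [hC₂, hC₁, Config.invoke, initConfig, hc]
  obtain ⟨E, hE, k₁, k₂, k₃, k₄, k₅⟩ := hA.exists_finish Set.univ (hr₂.deliver hpath) hcr₃.2
    g₁ (fun x hx => by
      rcases g₆ x hx with h | h
      · rcases f₆ x h with h | h
        · rcases e₆ x h with h | h
          · simp [hC₂, hC₁, Config.invoke, initConfig] at h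
          · exact ⟨w₁, trivial, h⟩
        · exact ⟨w₂, trivial, h⟩
      · exact ⟨w₁, trivial, h⟩)
    (fun w j hj => by
      rw [hround] at hj
      by_cases h₂ : w = w₂
      · subst h₂
        simp [hC₂, Config.invoke] at hj
        omega
      · by_cases h₁ : w = w₁
        · subst h₁
          simp [hC₂, hC₁, Config.invoke, h₂] at hj
          omega
        · simp [hC₂, hC₁, Config.invoke, initConfig, h₁, h₂] at hj)
  have hcr := Deliver.crashed hE
  obtain ⟨⟨L, hL, hL'⟩, -⟩ := Deliver.hist hE
  refine ⟨E, (hr₂.deliver hpath).deliver hE, hcr.1.trans hcr₃.1, hcr.2.trans hcr₃.2, k₁, k₂, k₃,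
    ?_, ?_, ?_⟩
  · intro s
    rw [k₄, g₅ s, f₅ s, e₅ s]
    by_cases h : s ∈ T <;>
      simp [h, mixedWrites, applyWrite, hC₂, hC₁, Config.invoke, initConfig, ← hm₁, ← hm₂]
  · intro r
    rw [k₅ _ (by simp), g₂, f₂, e₂]
    simp [hC₂, hC₁, Config.invoke, initConfig]
  · intro e he
    rw [hL, g₄, f₄, e₄, List.mem_append] at he
    rcases he with he | he
    · have : e = .inv (.inl w₁) a ∨ e = .inv (.inl w₂) b := by
        simpa [hC₂, hC₁, Config.invoke, initConfig] using he
      rcases this with rfl | rfl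
      · exact ⟨w₁, rfl⟩
      · exact ⟨w₂, rfl⟩
    · by_contra hne
      push Not at hne
      exact (hL' e he).1 (by rw [hround]; exact hround' _ hne)

end Implementation

end Register

/-! ### Two concurrent reads -/

namespace Register

namespace Implementation

open Relation AsyncSystem

variable {S W R : ℕ} {V : Type v} {A : Implementation.{u, v} S W R V}

/-- Two readers invoke a read. -/
def Config.startReads (C : A.Config) (r₁ r₂ : Fin R) : A.Config :=
  (C.invoke (.inr r₁) PUnit.unit).invoke (.inr r₂) PUnit.unit

/-- No process has crashed, all the writes have returned before two reads by `r₁` and `r₂` have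
been invoked, and `σ` is the history up to that time. -/
structure Reading (A : Implementation.{u, v} S W R V) (t : ℕ) (r₁ r₂ : Fin R)
    (σ : List (Event W R V)) (C : A.Config) : Prop where
  reachable : A.Reachable t C
  crashedServers : C.crashedServers = ∅
  crashedClients : C.crashedClients = ∅
  round : ∀ w, C.round (.inl w) = none
  writes : ∀ e ∈ σ, ∃ w, e.client = .inl w
  hist : ∃ τ, C.hist = σ ++ τ ∧ ∀ e ∈ τ, ∃ r, e.client = .inr r
  left_mem : .inv (.inr r₁) PUnit.unit ∈ C.hist
  right_mem : .inv (.inr r₂) PUnit.unit ∈ C.hist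

theorem Settled.reading {t : ℕ} {q : Fin S → A.ServerState} {C : A.Config}
    (hC : A.Settled t q C) {r₁ r₂ : Fin R} (hr : r₁ ≠ r₂) :
    A.Reading t r₁ r₂ C.hist (C.startReads r₁ r₂) where
  reachable := by
    refine (hC.reachable.step (.invoke C (.inr r₁) PUnit.unit ?_ (hC.round _))).step
      (.invoke _ (.inr r₂) PUnit.unit ?_ ?_)
    · simp [hC.crashedClients]
    · simp [Config.invoke, hC.crashedClients]
    · simp [Config.invoke, hr.symm, hC.round]
  crashedServers := hC.crashedServers
  crashedClients := hC.crashedClients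
  round w := by simp [Config.startReads, Config.invoke, hC.round]
  writes := hC.hist
  hist := ⟨[.inv (.inr r₁) PUnit.unit, .inv (.inr r₂) PUnit.unit],
    by simp [Config.startReads, Config.invoke], by simp⟩
  left_mem := by simp [Config.startReads, Config.invoke]
  right_mem := by simp [Config.startReads, Config.invoke]

/-- After the start of the reads, the servers and readers only depend on the states in which the
servers have been before. -/
theorem Settled.core_startReads {t : ℕ} {q q' : Fin S → A.ServerState} {C C' : A.Config}
    (hC : A.Settled t q C) (hC' : A.Settled t q' C') {r₁ r₂ : Fin R} (hr : r₁ ≠ r₂) :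
    (∀ p, (∀ s, p = .inl s → q s = q' s) →
      (C'.startReads r₁ r₂).core.state p = (C.startReads r₁ r₂).core.state p) ∧
    (C'.startReads r₁ r₂).core.buffer = (C.startReads r₁ r₂).core.buffer := by
  -- So far only writers have produced events, so the different write histories are invisible to the
  -- readers.
  have nil {q : Fin S → A.ServerState} {C : A.Config} (hC : A.Settled t q C) (r : Fin R) :
      C.hist.filter (fun e => e.client = Sum.inr r) = [] := by
    rw [List.filter_eq_nil_iff]
    intro e he
    obtain ⟨w, hw⟩ := hC.hist e he
    simp [hw]
  have client {q : Fin S → A.ServerState} {C : A.Config} (hC : A.Settled t q C) (c : Client W R)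
      (hc : ∀ w, c ≠ .inl w) : C.client c = A.clientInit c := by
    rcases c with w | r
    · exact absurd rfl (hc w)
    · exact hC.reader r
  have hr' : (Sum.inr r₂ : Client W R) ≠ .inr r₁ := by simpa using hr.symm
  constructor
  · intro p hp
    rcases p with s | r
    · simp [Config.core, Config.startReads, Config.invoke, hC.server, hC'.server, hp s rfl]
    · simp only [Config.core, Config.startReads, Config.invoke, List.filter_append, nil hC, nil hC',
        Function.update_of_ne hr', hC.reader, hC'.reader]
      refine Prod.ext ?_ (Prod.ext ?_ rfl)
      · by_cases h₂ : (Sum.inr r : Client W R) = .inr r₂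
        · simp only [h₂, Function.update_self]
        · by_cases h₁ : (Sum.inr r : Client W R) = .inr r₁
          · simp only [h₁, Function.update_of_ne hr'.symm, Function.update_self]
          · simp only [Function.update_of_ne h₂, Function.update_of_ne h₁, hC.reader, hC'.reader]
      · have : C'.round = C.round := funext fun c => (hC'.round c).trans (hC.round c).symm
        simp only [this]
  · simp only [Config.core, Config.startReads, Config.invoke, hC.toServer, hC'.toServer,
      hC.toClient, hC'.toClient, Function.update_of_ne hr', hC.reader, hC'.reader]

theorem Reading.deliver {t : ℕ} {r₁ r₂ : Fin R} {σ : List (Event W R V)} {C D : A.Config}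
    (hC : A.Reading t r₁ r₂ σ C) (h : ReflTransGen A.Deliver C D) : A.Reading t r₁ r₂ σ D := by
  obtain ⟨⟨L, hL, hL'⟩, hround⟩ := Deliver.hist h
  have hcr := Deliver.crashed h
  obtain ⟨τ, hτ, hτ'⟩ := hC.hist
  refine ⟨hC.reachable.deliver h, hcr.1.trans hC.crashedServers, hcr.2.trans hC.crashedClients,
    fun w => hround _ (hC.round w), hC.writes, ⟨τ ++ L, by rw [hL, hτ, List.append_assoc], ?_⟩,
    hL ▸ List.mem_append_left _ hC.left_mem, hL ▸ List.mem_append_left _ hC.right_mem⟩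
  intro e he
  rcases List.mem_append.1 he with he | he
  · exact hτ' e he
  · rcases hc : e.client with w | r
    · exact absurd (hC.round w) (hc ▸ (hL' e he).1)
    · exact ⟨r, rfl⟩

theorem Reading.exists_step {t : ℕ} {r₁ r₂ : Fin R} {σ : List (Event W R V)} {C : A.Config}
    (hC : A.Reading t r₁ r₂ σ C) {p : Fin S ⊕ Fin R} {Y : Conf A.LocalState A.Inbox}
    (h : AsyncSystem.Step A.system p C.core Y) :
    ∃ D, A.Deliver C D ∧ D.core = Y := by
  refine exists_deliver_of_core_step ?_ h
  rcases p with s | r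
  · simp [Config.Crashed, hC.crashedServers]
  · simp [Config.Crashed, hC.crashedClients]

theorem Reachable.exists_resp {t : ℕ} {C : A.Config} (hC : A.Reachable t C) {c : Client W R}
    {a : Arg V c} (ha : .inv c a ∈ C.hist) (hc : C.round c = none) : ∃ r, .resp c r ∈ C.hist := by
  obtain ⟨m, hm⟩ := List.mem_iff_getElem?.1 ha
  rcases hC.paired.of_inv m c a hm with ⟨r, n, ho⟩ | ⟨hp, -⟩
  · exact ⟨r, List.mem_of_getElem? ho.2.2.1⟩
  · exact absurd hc hp

/-- The reads return even if a server or one of the readers crashes. -/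
theorem Reading.resilient {t k : ℕ} {init : Option V} (hA : A.IsAtomicRegister t 1 k init)
    (ht : 1 ≤ t) {r₁ r₂ : Fin R} (hr : r₁ ≠ r₂) {σ : List (Event W R V)} {C : A.Config}
    (hC : A.Reading t r₁ r₂ σ C) (p : Fin S ⊕ Fin R) :
    ∃ D x, ReachAvoiding A.system p C.core D ∧ Decided A.returned D x := by
  -- Crash `p`: the core does not record crashes, and `1 ≤ t` permits the crash of a server. With
  -- two readers there is always a surviving one, whose read must return.
  obtain ⟨C', hreach, hcore, hround, hhist, hcrash, r, hr, hcl⟩ : ∃ C' : A.Config,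
      A.Reachable t C' ∧ C'.core = C.core ∧ C'.round = C.round ∧ C'.hist = C.hist ∧
        C'.Crashed p ∧ ∃ r, .inv (.inr r) PUnit.unit ∈ C.hist ∧
          .inr r ∉ C'.crashedClients := by
    rcases p with s | r
    · exact ⟨{ C with crashedServers := insert s C.crashedServers },
        hC.reachable.step (.crashServer C s (by simpa [hC.crashedServers] using ht)), rfl, rfl, rfl,
        Finset.mem_insert_self _ _, r₁, hC.left_mem, by simp [hC.crashedClients]⟩
    · refine ⟨{ C with crashedClients := insert (.inr r) C.crashedClients },
        hC.reachable.step (.crashClient C (.inr r)), rfl, rfl, rfl,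
        Finset.mem_insert_self _ _, ?_⟩
      by_cases h : r₁ = r
      · exact ⟨r₂, hC.right_mem, by simp [hC.crashedClients, ← h, hr.symm]⟩
      · exact ⟨r₁, hC.left_mem, by simp [hC.crashedClients, h]⟩
  obtain ⟨D, hD, -, hnone⟩ := hA.exists_complete hreach
  obtain ⟨⟨L, hL, -⟩, -⟩ := Deliver.hist hD
  obtain ⟨x, hx⟩ := (hreach.deliver hD).exists_resp (c := .inr r) (a := PUnit.unit)
    (by rw [hL, hhist]; exact List.mem_append_left _ hr) (hnone _ hcl)
  refine ⟨D.core, x, ?_, decided_core.2 ⟨r, hx⟩⟩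
  rw [← hcore]
  exact Deliver.core_reachAvoiding hD (fun w => by rw [hround]; exact hC.round w) hcrash

/-- Completion of an execution, in which all the events belong to operations. -/
theorem Reading.exists_complete {t k : ℕ} {init : Option V} (hA : A.IsAtomicRegister t 1 k init)
    {r₁ r₂ : Fin R} {σ : List (Event W R V)} {C : A.Config} (hC : A.Reading t r₁ r₂ σ C) :
    ∃ τ, (∀ e ∈ τ, ∃ r, e.client = .inr r) ∧ Atomic init (σ ++ τ) ∧
      (∀ c r, .resp c r ∈ C.hist → ∃ a m n, IsOperationOf (σ ++ τ) ⟨c, a, r, m, n⟩) ∧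
      ∀ c a, .inv c a ∈ C.hist → ∃ r m n, IsOperationOf (σ ++ τ) ⟨c, a, r, m, n⟩ := by
  obtain ⟨D, hD, -, hnone⟩ := hA.exists_complete hC.reachable
  have hD' := hC.deliver hD
  have hround : ∀ c, D.round c = none := fun c => hnone c (by simp [hC.crashedClients])
  obtain ⟨⟨L, hL, -⟩, -⟩ := Deliver.hist hD
  obtain ⟨τ, hτ, hτ'⟩ := hD'.hist
  have hpaired := hD'.reachable.paired
  have hsub : ∀ e ∈ C.hist, ∃ m, D.hist[m]? = some e := fun e he =>
    List.mem_iff_getElem?.1 (hL ▸ List.mem_append_left _ he)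
  refine ⟨τ, hτ', ?_⟩
  rw [← hτ]
  refine ⟨hA.atomic D hD'.reachable (hD'.reachable.wellFormed hround), ?_, ?_⟩
  · intro c r hr
    obtain ⟨n, hn⟩ := hsub _ hr
    obtain ⟨a, m, ho⟩ := hpaired.of_resp n c r hn
    exact ⟨a, m, n, ho⟩
  · intro c a ha
    obtain ⟨m, hm⟩ := hsub _ ha
    rcases hpaired.of_inv m c a hm with ⟨r, n, ho⟩ | ⟨hp, -⟩
    · exact ⟨r, m, n, ho⟩
    · exact absurd (hround c) hp

/-- After completion of the execution, both reads follow all the writes in one permutation `π`, so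
both return the final content of `π`. -/
theorem Reading.agree {t k : ℕ} {init : Option V} (hA : A.IsAtomicRegister t 1 k init)
    {r₁ r₂ : Fin R} {σ : List (Event W R V)} {C : A.Config} (hC : A.Reading t r₁ r₂ σ C)
    {x y : Option V} (hx : Decided A.returned C.core x) (hy : Decided A.returned C.core y) :
    x = y := by
  obtain ⟨r, hx⟩ := decided_core.1 hx
  obtain ⟨r', hy⟩ := decided_core.1 hy
  obtain ⟨τ, hτ, hat, hop, -⟩ := hC.exists_complete hA
  obtain ⟨π, -, -, hπ⟩ := hat.exists_content hC.writes hτ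
  obtain ⟨a, m, n, ho⟩ := hop _ _ hx
  obtain ⟨a', m', n', ho'⟩ := hop _ _ hy
  rw [hπ _ _ _ _ _ ho, hπ _ _ _ _ _ ho']

/-- The systems of servers and readers that arise after all the writes have returned, with a bound
on the number of further steps. -/
def ReadingCore (A : Implementation.{u, v} S W R V) (t k : ℕ) (r₁ r₂ : Fin R)
    (X : Conf A.LocalState A.Inbox) (n : ℕ) : Prop :=
  ∃ σ C, A.Reading t r₁ r₂ σ C ∧ C.core = X ∧ potential (max 1 k) C = n

theorem Reading.readingCore {t : ℕ} (k : ℕ) {r₁ r₂ : Fin R} {σ : List (Event W R V)}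
    {C : A.Config} (hC : A.Reading t r₁ r₂ σ C) :
    A.ReadingCore t k r₁ r₂ C.core (potential (max 1 k) C) :=
  ⟨σ, C, hC, rfl, rfl⟩

/-- The value returned by a read is determined by the states of servers and readers. -/
theorem Reading.univalent {t k : ℕ} {init : Option V} (hA : A.IsAtomicRegister t 1 k init)
    (ht : 1 ≤ t) {r₁ r₂ : Fin R} (hr : r₁ ≠ r₂) {σ : List (Event W R V)} {C : A.Config}
    (hC : A.Reading t r₁ r₂ σ C) {X Y : Conf A.LocalState A.Inbox} {x y : Option V}
    (hX : Reach A.system C.core X) (hY : Reach A.system C.core Y)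
    (hx : Decided A.returned X x) (hy : Decided A.returned Y y) : x = y := by
  -- Every abstract configuration carries an actual execution behind it, to which termination, crash
  -- tolerance and atomicity apply.
  refine AsyncSystem.univalent (G := A.ReadingCore t k r₁ r₂) (Φ := A.system) returned_react
    ?_ ?_ ?_ (hC.readingCore k) hX hY hx hy
  · rintro _ _ p Y ⟨σ, C, hC, rfl, rfl⟩ h
    obtain ⟨D, hD, rfl⟩ := hC.exists_step h
    have hD' := hC.deliver (.single hD)
    exact ⟨_, hD.potential_lt (hA.roundTrips.le_max hD'.reachable), hD'.readingCore k⟩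
  · rintro _ _ ⟨σ, C, hC, rfl, rfl⟩ p
    exact hC.resilient hA ht hr p
  · rintro _ _ ⟨σ, C, hC, rfl, rfl⟩ x y hx hy
    exact hC.agree hA hx hy

theorem Reading.exists_reach {t : ℕ} {r₁ r₂ : Fin R} {σ : List (Event W R V)} {C : A.Config}
    (hC : A.Reading t r₁ r₂ σ C) {X : Conf A.LocalState A.Inbox}
    (hX : Reach A.system C.core X) : ∃ D, A.Reading t r₁ r₂ σ D ∧ D.core = X := by
  induction hX with
  | refl => exact ⟨C, hC, rfl⟩
  | tail _ h ih =>
    obtain ⟨D, hD, rfl⟩ := ih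
    obtain ⟨p, h⟩ := h
    obtain ⟨E, hE, rfl⟩ := hD.exists_step h
    exact ⟨E, hD.deliver (.single hE), rfl⟩

/-- Every value that is returned by a read in an execution from `X` is `x`. -/
def AllReturn (A : Implementation.{u, v} S W R V) (X : Conf A.LocalState A.Inbox)
    (x : Option V) : Prop :=
  ∀ Y y, Reach A.system X Y → Decided A.returned Y y → y = x

/-- `AllReturn` is never vacuous here, because some run does return a value. -/
theorem AllReturn.unique {t k : ℕ} {init : Option V} (hA : A.IsAtomicRegister t 1 k init)
    (ht : 1 ≤ t) {r₁ r₂ : Fin R} (hr : r₁ ≠ r₂) {σ : List (Event W R V)} {C : A.Config}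
    (hC : A.Reading t r₁ r₂ σ C) {x y : Option V} (hx : A.AllReturn C.core x)
    (hy : A.AllReturn C.core y) : x = y := by
  obtain ⟨D, z, hD, hz⟩ := hC.resilient hA ht hr (.inr r₁)
  rw [← hx D z hD.reach hz, ← hy D z hD.reach hz]

/-- The core forgets the writers and their events. Concurrent writes can thus be confused with
consecutive ones that leave the servers in the same states, which settles both ends of the chain. -/
theorem AllReturn.congr {t : ℕ} {r₁ r₂ : Fin R} (hr : r₁ ≠ r₂) {q q' : Fin S → A.ServerState}
    {C C' : A.Config} (hC : A.Settled t q C) (hC' : A.Settled t q' C') (hq : ∀ s, q s = q' s)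
    {x : Option V} (hx : A.AllReturn (C.startReads r₁ r₂).core x) :
    A.AllReturn (C'.startReads r₁ r₂).core x := by
  obtain ⟨h₁, h₂⟩ := hC.core_startReads hC' hr
  rwa [Conf.ext (funext fun p => h₁ p fun s _ => hq s) h₂]

/-- The value returned by the reads does not depend on the state of a single server. -/
theorem AllReturn.congr_server {t k : ℕ} {init : Option V} (hA : A.IsAtomicRegister t 1 k init)
    (ht : 1 ≤ t) {r₁ r₂ : Fin R} (hr : r₁ ≠ r₂) {q q' : Fin S → A.ServerState} {C C' : A.Config}
    (hC : A.Settled t q C) (hC' : A.Settled t q' C') (s : Fin S)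
    (hq : ∀ s', s' ≠ s → q s' = q' s') {x : Option V}
    (hx : A.AllReturn (C.startReads r₁ r₂).core x) :
    A.AllReturn (C'.startReads r₁ r₂).core x := by
  -- A run in which `s` takes no step returns some `z`, and the same run is possible from `C'`.
  -- Univalence of `C'` then makes `z` the only value there.
  obtain ⟨D, z, hD, hz⟩ := (hC.reading hr).resilient hA ht hr (.inl s)
  obtain ⟨h₁, h₂⟩ := hC.core_startReads hC' hr
  obtain ⟨D', hD', hs, -⟩ := hD.congr
    (fun p hp => h₁ p fun s' hs' => hq s' fun h => hp (hs'.trans (by rw [h]))) h₂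
  have hz' : Decided A.returned D' z := by
    -- Only readers decide, so it does not matter that the two runs end with different states of
    -- `s`.
    obtain ⟨s' | r, h⟩ := hz
    · exact h.elim
    · exact ⟨.inr r, by rwa [hs _ (by simp)]⟩
  intro Y y hY hy
  rw [← hx D z hD.reach hz]
  exact (hC'.reading hr).univalent hA ht hr hY hD'.reach hy hz'

/-- After two consecutive writes, the reads return the value of the second one. -/
theorem allReturn_of_write_write {t k : ℕ} {init : Option V} (hA : A.IsAtomicRegister t 1 k init)
    {r₁ r₂ : Fin R} (hr : r₁ ≠ r₂) {w₁ w₂ : Fin W} (hw : w₁ ≠ w₂)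
    {b : V} {q : Fin S → A.ServerState} {C : A.Config} (hC : A.Settled t q C)
    {σ₁ σ₂ : List (Event W R V)} (hσ : C.hist = σ₁ ++ σ₂) (hσ₁ : ∀ e ∈ σ₁, e.client = .inl w₁)
    (hσ₂ : ∀ e ∈ σ₂, e.client = .inl w₂) (hb : .inv (.inl w₂) b ∈ σ₂)
    (hb' : ∀ x : V, .inv (.inl w₂) x ∈ σ₂ → x = b) :
    A.AllReturn (C.startReads r₁ r₂).core (some b) := by
  intro Y y hY hy
  obtain ⟨D, hD, rfl⟩ := (hC.reading hr).exists_reach hY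
  obtain ⟨r, hy⟩ := decided_core.1 hy
  obtain ⟨τ, hτ, hat, hresp, hinv⟩ := hD.exists_complete hA
  obtain ⟨ρ, hρ, -⟩ := hD.hist
  obtain ⟨a, m, n, ho⟩ := hresp _ _ hy
  obtain ⟨u, m', n', ho'⟩ := hinv (.inl w₂) b (by simp [hρ, hσ, hb])
  rw [hσ] at hat ho ho'
  exact hat.read_eq hw hσ₁ hσ₂ hτ hb' ho' ho

end Implementation

end Register

/-! ### The chain that reverses the order of the writes server by server -/

theorem theorem1 {V : Type v} [Nontrivial V] (init : Option V) (S W R t k : ℕ)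
    (ht : 1 ≤ t) (hW : 2 ≤ W) (hR : 2 ≤ R) (hk : 2 ≤ k) :
    ¬ ∃ A : Register.Implementation.{u, v} S W R V, A.IsAtomicRegister t 1 k init := by
  rintro ⟨A, hA⟩
  obtain ⟨a, b, hab⟩ := exists_pair_ne V
  obtain ⟨w₁, w₂, hw⟩ : ∃ w₁ w₂ : Fin W, w₁ ≠ w₂ :=
    ⟨⟨0, by omega⟩, ⟨1, by omega⟩, by simp⟩
  obtain ⟨r₁, r₂, hr⟩ : ∃ r₁ r₂ : Fin R, r₁ ≠ r₂ :=
    ⟨⟨0, by omega⟩, ⟨1, by omega⟩, by simp⟩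
  obtain ⟨C, σ₁, σ₂, hC, hσ, hσ₁, hσ₂, hb, hb'⟩ := hA.exists_write_write hw a b
  obtain ⟨D, ρ₁, ρ₂, hD, hρ, hρ₁, hρ₂, ha, ha'⟩ := hA.exists_write_write hw.symm b a
  choose E hE using hA.exists_mixedWrites hw a b
  -- For `T = ∅` every server sees `a` before `b`, as in consecutive writes; adding a server to `T`
  -- changes the state of that server only.
  have key : ∀ T, A.AllReturn ((E T).startReads r₁ r₂).core (some b) := by
    intro T
    induction T using Finset.induction_on with
    | empty =>
      refine Register.Implementation.AllReturn.congr hr hC (hE ∅) ?_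
        (Register.Implementation.allReturn_of_write_write hA hr hw hC hσ hσ₁ hσ₂ hb hb')
      intro s
      simp [Register.Implementation.mixedWrites]
    | @insert s T _ ih =>
      refine Register.Implementation.AllReturn.congr_server hA ht hr (hE T)
        (hE (insert s T)) s ?_ ih
      intro s' hs'
      simp [Register.Implementation.mixedWrites, hs']
  -- With all servers in `T`, their states are those after a complete write of `b` followed by one
  -- of `a`.
  have hDa : A.AllReturn ((E Finset.univ).startReads r₁ r₂).core (some a) := by
    refine Register.Implementation.AllReturn.congr hr hD (hE _) ?_
      (Register.Implementation.allReturn_of_write_write hA hr hw.symm hD hρ hρ₁ hρ₂ ha ha')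
    intro s
    simp [Register.Implementation.mixedWrites]
  have := Register.Implementation.AllReturn.unique hA ht hr ((hE Finset.univ).reading hr) hDa
    (key _)
  exact hab (by simpa using this)
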